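/- Consider one-mode Fock space with number basis $|0\rangle,|1\rangle,\dots$, coherent states $|\underline{\alpha}\rangle=e^{-|\alpha|^2/2}\sum_{j\ge 0}\frac{\alpha^j}{\sqrt{j!}}|j\rangle$, even cat states $|\mathrm{cat}\rangle^+_\alpha=\frac{|\underline{\alpha}\rangle+|\underline{-\alpha}\rangle}{\sqrt{2+2e^{-2|\alpha|^2}}}$, and the squeezed vacuum $|r\rangle_{\rm sq}=\frac1{\sqrt{\cosh r}}\sum_{l\ge 0}(-\tanh r)^l\frac{\sqrt{(2l)!}}{2^l l!}|2l\rangle$, $r\in\mathbb R$. Let $\eta\in[0,1]$ and let $k\ge 0$, $n\ge 1$ be integers with $k\le n$. The squeezed vacuum (mode $a$) and a vacuum mode $b$ enter a beamsplitter acting by $a^\dagger\mapsto\sqrt{1-\eta}\,a^\dagger+i\sqrt\eta\,b^\dagger$, $b^\dagger\mapsto i\sqrt\eta\,a^\dagger+\sqrt{1-\eta}\,b^\dagger$; mode $b$ is the output mode. Mode $a$ is sent to a lossless $n$-plexed photon-number-resolving detector without dark counts: a balanced $n$-port linear network (a unitary mode transformation, with vacuum in the $n-1$ other inputs, that splits the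 incoming light equally over the $n$ outputs), each output being measured by an ON-OFF detector $\{|0\rangle\langle 0|,\,I-|0\rangle\langle 0|\}$. Let $p$ be the probability that exactly $k$ detectors click, and (if $p>0$) let $\rho$ be the normalised state of mode $b$ conditioned on this event. (1) The integral below converges absolutely in operator norm, and $$p\,\rho=\frac{n!}{(n-k)!\,k!}\int_{\mathbb C^2}\frac{d^2\alpha\,d^2\beta}{\pi^2}\,\frac1{\cosh r}\,e^{-\tanh r\,\frac{(\alpha^{*})^2}{2}}e^{-\frac{|\alpha|^2}2}\,e^{-\tanh r\,\frac{\beta^{2}}{2}}e^{-\frac{|\beta|^2}2}\,e^{-\frac{(1-\eta)(|\alpha|^2+|\beta|^2)}{2}}\left\{e^{\frac{(1-\eta)\alpha\beta^*}{n}}-1\right\}^k\left|\underline{\sqrt\eta\,i\alpha}\right\rangle\left\langle\underline{\sqrt\eta\,i\beta}\right| ,$$ where the left-hand side is read as $0$ if $p=0$. (2) Let $|\widetilde{\mathrm{cat}}\rangle$ be the normalised state of mode $b$ obtained when mode $a$ is instead measured by an ideal photon-number-resolving detector with outcome $k$, and put $F_{\rm mpnr}=\langle\mathrm{cat}|^+_{\sqrt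 k}\,\rho\,|\mathrm{cat}\rangle^+_{\sqrt k}$ and $F_{\rm pnr}=\bigl|\langle\mathrm{cat}|^+_{\sqrt k}|\widetilde{\mathrm{cat}}\rangle\bigr|^2$. Then $$F_{\rm mpnr}=F_{\rm pnr}-\mathcal O\!\left(\frac{1-\eta}{n}\right)$$ in the following sense: for all $r$, $k$ and every real $\eta_0$, where $\eta_0>0$ if $k$ is odd, there is a constant $C$, depending only on $r,k,\eta_0$, such that for all $\eta\in[0,1]$ with $\eta\ge\eta_0$ for which the ideal outcome $k$ has positive probability, all $n\ge\max(k,1)$ and all balanced networks, $p>0$ and $|F_{\rm mpnr}-F_{\rm pnr}|\le C\,\frac{1-\eta}{n}$. The ideal outcome $k$ does have positive probability if $r\ne 0$, $\eta<1$, and $k$ is even or $\eta>0$. -/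

import Mathlib

open scoped ComplexConjugate lp

noncomputable section

namespace CatBreeding

open MvPolynomial InnerProductSpace ContinuousLinearMap

/-! ### Hilbert spaces with a distinguished orthonormal basis -/

/-- The linear isometry of Hilbert spaces that sends the standard orthonormal basis of
`ℓ²(κ)` to a given orthonormal family. -/
def basisIsometry {κ E : Type*} [NormedAddCommGroup E] [InnerProductSpace ℂ E] [CompleteSpace E]
    (v : κ → E) (hv : Orthonormal ℂ v) : ℓ²(κ, ℂ) →ₗᵢ[ℂ] E :=
  hv.orthogonalFamily.linearIsometry

/-- The standard basis vector `|m⟩` of `ℓ²(κ)`. -/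
def ket {κ : Type*} (m : κ) : ℓ²(κ, ℂ) := by
  classical exact lp.single 2 m 1

theorem ket_apply {κ : Type*} [DecidableEq κ] (m j : κ) :
    (ket m : ℓ²(κ, ℂ)) j = if j = m then 1 else 0 := by
  have h : (ket m : ℓ²(κ, ℂ)) = lp.single 2 m 1 := by
    unfold ket
    congr
    exact Subsingleton.elim _ _
  rw [h, lp.single_apply, Pi.single_apply]

theorem inner_ket {κ : Type*} (m : κ) (ψ : ℓ²(κ, ℂ)) : inner ℂ (ket m) ψ = ψ m := by
  classical
  have h : (ket m : ℓ²(κ, ℂ)) = lp.single 2 m 1 := by unfold ket; congr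
  rw [h, lp.inner_single_left]
  simp

theorem orthonormal_ket {κ : Type*} : Orthonormal ℂ (ket : κ → ℓ²(κ, ℂ)) := by
  classical
  rw [orthonormal_iff_ite]
  intro i j
  rw [inner_ket, ket_apply]

theorem basisIsometry_ket {κ E : Type*} [NormedAddCommGroup E] [InnerProductSpace ℂ E]
    [CompleteSpace E] (v : κ → E) (hv : Orthonormal ℂ v) (m : κ) :
    basisIsometry v hv (ket m) = v m := by
  classical
  have h : (ket m : ℓ²(κ, ℂ)) = lp.single 2 m 1 := by unfold ket; congr
  rw [h, basisIsometry, hv.orthogonalFamily.linearIsometry_apply_single]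
  simp

/-- The isometric inclusion `ℓ²(κ') → ℓ²(κ)`, `|j⟩ ↦ |f j⟩`, of an injection `f`. -/
def basisIncl {κ' κ : Type*} (f : κ' ↪ κ) : ℓ²(κ', ℂ) →L[ℂ] ℓ²(κ, ℂ) :=
  (basisIsometry (fun j => ket (f j))
    (orthonormal_ket.comp f f.injective)).toContinuousLinearMap

theorem adjoint_basisIncl_apply {κ' κ : Type*} (f : κ' ↪ κ) (ψ : ℓ²(κ, ℂ)) (j : κ') :
    adjoint (basisIncl f) ψ j = ψ (f j) := by
  rw [← inner_ket, adjoint_inner_right]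
  have : basisIncl f (ket j) = ket (f j) :=
    basisIsometry_ket _ (orthonormal_ket.comp f f.injective) j
  rw [this, inner_ket]

/-- The orthogonal projector onto the closed span of the basis vectors `|m⟩`, `m ∈ s`. -/
def diagProj {κ : Type*} (s : Set κ) : ℓ²(κ, ℂ) →L[ℂ] ℓ²(κ, ℂ) :=
  basisIncl (Function.Embedding.subtype (· ∈ s)) ∘L
    adjoint (basisIncl (Function.Embedding.subtype (· ∈ s)))

theorem diagProj_apply {κ : Type*} (s : Set κ) [DecidablePred (· ∈ s)] (ψ : ℓ²(κ, ℂ)) (m : κ) :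
    diagProj s ψ m = if m ∈ s then ψ m else 0 := by
  have key : adjoint (basisIncl (Function.Embedding.subtype (· ∈ s))) (ket m) =
      if h : m ∈ s then ket (⟨m, h⟩ : {m // m ∈ s}) else 0 := by
    classical
    ext j
    rw [adjoint_basisIncl_apply, ket_apply]
    by_cases h : m ∈ s
    · rw [dif_pos h, ket_apply]
      simp only [Subtype.ext_iff]
      congr
    · rw [dif_neg h]
      have : (j : κ) ≠ m := fun e => h (e ▸ j.2)
      simp [this]
  rw [← inner_ket, diagProj, comp_apply, ← adjoint_inner_left, key]
  split_ifs with h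
  · rw [inner_ket, adjoint_basisIncl_apply]
    rfl
  · simp

/-! ### Bosonic Fock space and passive linear optics -/

/-- The Fock space of bosonic modes labelled by `ι`: square-summable amplitudes indexed by
occupation numbers. -/
abbrev Fock (ι : Type*) := ℓ²(ι →₀ ℕ, ℂ)

/-- The space of a single mode, with number basis `|0⟩, |1⟩, …`. -/
abbrev Mode := ℓ²(ℕ, ℂ)

section LinearOptics

variable {ι : Type*} [Fintype ι]

/-- The vector `p(a†)|vac⟩` of a polynomial `p` in the creation operators: since
`∏ᵢ (aᵢ†)^{mᵢ} |vac⟩ = √(∏ᵢ mᵢ!) |m⟩`, its amplitude at `m` is `√(∏ᵢ mᵢ!)` times the coefficient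
of `p` at `m`. -/
def creation : MvPolynomial ι ℂ →ₗ[ℂ] Fock ι where
  toFun p := ⟨fun m => (√(∏ i, ((m i).factorial : ℝ)) : ℂ) * coeff m p,
    (memℓp_zero (p.support.finite_toSet.subset fun m hm => by
      simp only [Set.mem_ofPred_eq, ne_eq, mul_eq_zero, not_or] at hm
      simpa using hm.2)).of_exponent_ge zero_le⟩
  map_add' p q := by
    ext m
    simp only [coeff_add, mul_add]
    rfl
  map_smul' c p := by
    ext m
    simp only [coeff_smul, smul_eq_mul, RingHom.id_apply, mul_left_comm _ c]
    rfl

theorem creation_apply (p : MvPolynomial ι ℂ) (m : ι →₀ ℕ) :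
    creation p m = (√(∏ i, ((m i).factorial : ℝ)) : ℂ) * coeff m p := rfl

/-- The substitution `aᵢ† ↦ ∑ₗ U l i • aₗ†` in polynomials in the creation operators. -/
def substitute (U : Matrix ι ι ℂ) : MvPolynomial ι ℂ →ₐ[ℂ] MvPolynomial ι ℂ :=
  aeval fun i => ∑ l, C (U l i) * X l

/-- The vector `∏ᵢ (∑ₗ U l i • aₗ†)^{mᵢ} / √(mᵢ!) |vac⟩`. -/
def transformedKet (U : Matrix ι ι ℂ) (m : ι →₀ ℕ) : Fock ι :=
  (√(∏ i, ((m i).factorial : ℝ)) : ℂ)⁻¹ • creation (∏ i, (∑ l, C (U l i) * X l) ^ m i)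

theorem sqrt_fact_ne_zero (m : ι →₀ ℕ) : (√(∏ i, ((m i).factorial : ℝ)) : ℂ) ≠ 0 := by
  have : (0 : ℝ) < ∏ i, ((m i).factorial : ℝ) :=
    Finset.prod_pos fun i _ => by exact_mod_cast Nat.factorial_pos _
  exact_mod_cast (Real.sqrt_pos.2 this).ne'

theorem creation_monomial (m : ι →₀ ℕ) (c : ℂ) :
    creation (monomial m c) = (c * (√(∏ i, ((m i).factorial : ℝ)) : ℂ)) • ket m := by
  classical
  ext j
  rw [creation_apply, coeff_monomial, lp.coeFn_smul, Pi.smul_apply, ket_apply]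
  by_cases h : m = j
  · subst h; simp [mul_comm]
  · simp [h, Ne.symm h]

theorem inner_creation_monomial (m : ι →₀ ℕ) (c : ℂ) (q : MvPolynomial ι ℂ) :
    inner ℂ (creation (monomial m c)) (creation q) =
      conj c * ((∏ i, ((m i).factorial : ℝ) : ℝ) : ℂ) * coeff m q := by
  rw [creation_monomial, inner_smul_left, inner_ket, creation_apply, map_mul, Complex.conj_ofReal]
  have : (√(∏ i, ((m i).factorial : ℝ)) : ℂ) * (√(∏ i, ((m i).factorial : ℝ)) : ℂ)
      = ((∏ i, ((m i).factorial : ℝ) : ℝ) : ℂ) := by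
    rw [← Complex.ofReal_mul, Real.mul_self_sqrt]
    positivity
  rw [← this]
  ring

theorem inner_creation_X_mul (i : ι) (p q : MvPolynomial ι ℂ) :
    inner ℂ (creation (X i * p)) (creation q) =
      inner ℂ (creation p) (creation (pderiv i q)) := by
  classical
  induction p using MvPolynomial.induction_on' with
  | monomial m c =>
    have h1 : (X i : MvPolynomial ι ℂ) * monomial m c = monomial (m + Finsupp.single i 1) c := by
      rw [X, monomial_mul, one_mul, add_comm]
    have h2 : (∏ j, ((((m + Finsupp.single i 1 : ι →₀ ℕ)) j).factorial : ℝ)) =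
        (∏ j, ((m j).factorial : ℝ)) * (m i + 1) := by
      rw [← Finset.mul_prod_erase Finset.univ _ (Finset.mem_univ i),
        ← Finset.mul_prod_erase Finset.univ (fun j => ((m j).factorial : ℝ)) (Finset.mem_univ i)]
      have : ∀ j ∈ Finset.univ.erase i, ((((m + Finsupp.single i 1 : ι →₀ ℕ)) j).factorial : ℝ) =
          ((m j).factorial : ℝ) := by
        intro j hj
        have hj' : i ≠ j := (Finset.ne_of_mem_erase hj).symm
        simp [hj']
      rw [Finset.prod_congr rfl this]
      simp only [Finsupp.add_apply, Finsupp.single_eq_same, Nat.factorial_succ]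
      push_cast
      ring
    rw [h1, inner_creation_monomial, inner_creation_monomial, coeff_pderiv, h2]
    push_cast
    ring
  | add p p' hp hp' => simp only [mul_add, map_add, inner_add_left, hp, hp']

theorem pderiv_substitute (U : Matrix ι ι ℂ) (l : ι) (q : MvPolynomial ι ℂ) :
    pderiv l (substitute U q) = ∑ i, C (U l i) * substitute U (pderiv i q) := by
  classical
  induction q using MvPolynomial.induction_on with
  | C a => simp [substitute]
  | add p q hp hq => simp only [map_add, hp, hq, mul_add, Finset.sum_add_distrib]
  | mul_X p i hp =>
    have hX : pderiv l (substitute U (X i)) = C (U l i) := by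
      simp [substitute, pderiv_X, Pi.single_apply, Finset.sum_ite_eq']
    rw [map_mul, pderiv_mul, hp, hX, Finset.sum_mul]
    simp only [pderiv_mul, map_add, map_mul, mul_add, Finset.sum_add_distrib]
    congr 1
    · exact Finset.sum_congr rfl fun j _ => by ring
    · rw [Finset.sum_eq_single i]
      · simp; ring
      · intro j _ hj
        simp [pderiv_X, Ne.symm hj]
      · simp

variable [DecidableEq ι]

theorem inner_creation_substitute (U : Matrix.unitaryGroup ι ℂ) (p q : MvPolynomial ι ℂ) :
    inner ℂ (creation (substitute (U : Matrix ι ι ℂ) p)) (creation (substitute U q)) =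
      inner ℂ (creation p) (creation q) := by
  classical
  induction p using MvPolynomial.induction_on generalizing q with
  | C a =>
    have h0 : coeff 0 (substitute (U : Matrix ι ι ℂ) q) = coeff 0 q := by
      have : (constantCoeff : MvPolynomial ι ℂ →+* ℂ).comp
          (substitute (U : Matrix ι ι ℂ)).toRingHom = constantCoeff := by
        apply MvPolynomial.ringHom_ext
        · intro r; simp [substitute]
        · intro i; simp [substitute]
      simpa [constantCoeff_eq] using RingHom.congr_fun this q
    have hC : substitute (U : Matrix ι ι ℂ) (C a) = monomial 0 a := by simp [substitute]
    rw [hC, show (C a : MvPolynomial ι ℂ) = monomial 0 a from rfl, inner_creation_monomial,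
      inner_creation_monomial, h0]
  | add p p' hp hp' => simp only [map_add, inner_add_left, hp, hp']
  | mul_X p i hp =>
    have hX : substitute (U : Matrix ι ι ℂ) (p * X i) =
        ∑ l, (U : Matrix ι ι ℂ) l i • (X l * substitute (U : Matrix ι ι ℂ) p) := by
      rw [map_mul]
      have : substitute (U : Matrix ι ι ℂ) (X i) = ∑ l, C ((U : Matrix ι ι ℂ) l i) * X l := by
        simp [substitute]
      rw [this, mul_comm, Finset.sum_mul]
      refine Finset.sum_congr rfl fun l _ => ?_
      rw [MvPolynomial.smul_eq_C_mul]
      ring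
    have hU : ∀ j, ∑ l, conj ((U : Matrix ι ι ℂ) l i) * (U : Matrix ι ι ℂ) l j =
        if i = j then 1 else 0 := by
      intro j
      have := congrFun (congrFun (Matrix.mem_unitaryGroup_iff'.1 U.2) i) j
      simpa [Matrix.mul_apply, Matrix.one_apply, Matrix.star_apply] using this
    have hder : ∑ l, conj ((U : Matrix ι ι ℂ) l i) • pderiv l (substitute (U : Matrix ι ι ℂ) q) =
        substitute (U : Matrix ι ι ℂ) (pderiv i q) := by
      simp only [pderiv_substitute, MvPolynomial.smul_eq_C_mul, Finset.mul_sum]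
      rw [Finset.sum_comm]
      simp only [← mul_assoc, ← map_mul, ← Finset.sum_mul, ← map_sum, hU]
      simp
    rw [hX, map_sum, sum_inner]
    simp only [map_smul, inner_smul_left, inner_creation_X_mul]
    rw [mul_comm p, inner_creation_X_mul, ← hp, ← hder, map_sum, inner_sum]
    simp only [map_smul, inner_smul_right]

theorem orthonormal_transformedKet (U : Matrix.unitaryGroup ι ℂ) :
    Orthonormal ℂ (transformedKet (U : Matrix ι ι ℂ)) := by
  classical
  have h : ∀ m, transformedKet (U : Matrix ι ι ℂ) m = creation (substitute (U : Matrix ι ι ℂ)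
      (monomial m ((√(∏ i, ((m i).factorial : ℝ)) : ℂ)⁻¹))) := by
    intro m
    rw [transformedKet, ← map_smul, substitute, aeval_monomial, MvPolynomial.smul_eq_C_mul,
      Finsupp.prod_fintype _ _ (by simp)]
    rfl
  rw [orthonormal_iff_ite]
  intro m m'
  rw [h, h, inner_creation_substitute, creation_monomial, creation_monomial,
    inv_mul_cancel₀ (sqrt_fact_ne_zero _), inv_mul_cancel₀ (sqrt_fact_ne_zero _), one_smul,
    one_smul, inner_ket, ket_apply]

/-- The action on Fock space of a passive linear-optical network with mode matrix `U`. It fixes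
the vacuum and transforms the creation operators by `aᵢ† ↦ ∑ₗ U l i • aₗ†`, that is,
`|m⟩ ↦ ∏ᵢ (∑ₗ U l i • aₗ†)^{mᵢ} / √(mᵢ!) |vac⟩`. -/
def linearOptics (U : Matrix.unitaryGroup ι ℂ) : Fock ι →ₗᵢ[ℂ] Fock ι :=
  basisIsometry (transformedKet (U : Matrix ι ι ℂ)) (orthonormal_transformedKet U)

end LinearOptics

/-! ### States of a single mode -/

theorem memℓp_two {κ : Type*} {f : κ → ℂ} (h : Summable fun j => ‖f j‖ ^ 2) :
    Memℓp f 2 := by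
  refine memℓp_gen ?_
  simpa using h

theorem memℓp_coherent (α : ℂ) :
    Memℓp (fun j : ℕ => (Real.exp (-‖α‖ ^ 2 / 2) : ℂ) * (α ^ j / (√(j.factorial : ℝ) : ℂ))) 2 := by
  refine memℓp_two ?_
  have := (Real.summable_pow_div_factorial (‖α‖ ^ 2)).mul_left (Real.exp (-‖α‖ ^ 2 / 2) ^ 2)
  refine this.congr fun j => ?_
  have h : (0 : ℝ) ≤ (j.factorial : ℝ) := by positivity
  rw [norm_mul, norm_div, norm_pow, Complex.norm_real, Complex.norm_real, mul_pow, div_pow,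
    Real.norm_of_nonneg (Real.sqrt_nonneg _), Real.sq_sqrt h,
    Real.norm_of_nonneg (Real.exp_pos _).le, ← pow_mul, ← pow_mul, mul_comm j 2]

/-- The coherent state `|α⟩ = e^{-|α|²/2} ∑ⱼ α^j / √(j!) |j⟩`. -/
def coherent (α : ℂ) : Mode :=
  ⟨fun j => (Real.exp (-‖α‖ ^ 2 / 2) : ℂ) * (α ^ j / (√(j.factorial : ℝ) : ℂ)), memℓp_coherent α⟩

/-- The even cat state `(|α⟩ + |-α⟩) / √(2 + 2 e^{-2|α|²})`. -/
def evenCat (α : ℂ) : Mode :=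
  (√(2 + 2 * Real.exp (-2 * ‖α‖ ^ 2)) : ℂ)⁻¹ • (coherent α + coherent (-α))

/-- Number amplitudes of the squeezed vacuum: `(cosh r)^{-1/2} (-tanh r)^l √((2l)!) / (2^l l!)`
at `j = 2l`, and `0` at odd `j`. -/
def squeezedAmp (r : ℝ) (j : ℕ) : ℝ :=
  if Even j then
    (√(Real.cosh r))⁻¹ * ((-Real.tanh r) ^ (j / 2) * √(j.factorial : ℝ) /
      (2 ^ (j / 2) * ((j / 2).factorial : ℝ)))
  else 0

theorem memℓp_squeezed (r : ℝ) : Memℓp (fun j : ℕ => (squeezedAmp r j : ℂ)) 2 := by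
  refine memℓp_two ?_
  have ht : Real.tanh r ^ 2 < 1 := by
    rw [Real.tanh_eq_sinh_div_cosh, div_pow, div_lt_one (by positivity), Real.cosh_sq]
    linarith
  have hs : Summable fun l : ℕ => ‖(squeezedAmp r (2 * l) : ℂ)‖ ^ 2 := by
    refine Summable.of_nonneg_of_le (fun _ => by positivity) (fun l => ?_)
      ((summable_geometric_of_lt_one (sq_nonneg (Real.tanh r)) ht).mul_left (Real.cosh r)⁻¹)
    have h1 : ((2 * l).factorial : ℝ) ≤ 4 ^ l * (l.factorial : ℝ) ^ 2 := by
      have h := Nat.four_pow_le_two_mul_self_mul_centralBinom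
      have hc : Nat.centralBinom l ≤ 4 ^ l := by
        rw [Nat.centralBinom_eq_two_mul_choose]
        calc (2 * l).choose l ≤ 2 ^ (2 * l) := Nat.choose_le_two_pow _ _
          _ = 4 ^ l := by rw [pow_mul]; norm_num
      have h2 : (2 * l).factorial = Nat.centralBinom l * l.factorial ^ 2 := by
        have := Nat.choose_mul_factorial_mul_factorial (show l ≤ 2 * l by omega)
        rw [Nat.centralBinom_eq_two_mul_choose, ← this, show 2 * l - l = l by omega]
        ring
      rw [h2]
      exact_mod_cast Nat.mul_le_mul_right _ hc
    have h3 : (0 : ℝ) < l.factorial := by exact_mod_cast Nat.factorial_pos l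
    have h4 : (0 : ℝ) < Real.cosh r := Real.cosh_pos r
    rw [Complex.norm_real, Real.norm_eq_abs, sq_abs, squeezedAmp, if_pos (even_two_mul l),
      show 2 * l / 2 = l by omega, mul_pow, inv_pow, Real.sq_sqrt h4.le, div_pow, mul_pow,
      Real.sq_sqrt (by positivity)]
    refine mul_le_mul_of_nonneg_left ?_ (by positivity)
    rw [div_le_iff₀ (by positivity)]
    have h5 : ((2 : ℝ) ^ l * l.factorial) ^ 2 = 4 ^ l * (l.factorial : ℝ) ^ 2 := by
      rw [mul_pow, ← pow_mul, mul_comm l 2, pow_mul]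
      norm_num
    rw [h5, ← pow_mul, mul_comm l 2, pow_mul, neg_sq]
    exact mul_le_mul_of_nonneg_left h1 (by positivity)
  have hinj : Function.Injective fun l : ℕ => 2 * l := fun a b h => by simpa using h
  refine (hinj.summable_iff ?_).1 hs
  intro j hj
  have : ¬ Even j := fun ⟨l, hl⟩ => hj ⟨l, by simp only; omega⟩
  simp [squeezedAmp, this]

/-- The single-mode squeezed vacuum with squeezing amplitude `r`. -/
def squeezedVacuum (r : ℝ) : Mode := ⟨fun j => (squeezedAmp r j : ℂ), memℓp_squeezed r⟩

/-! ### The breeding protocol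

The modes are the detector modes `D` together with one output mode `inr ()`. -/

/-- `|ψ⟩` in mode `x` and vacuum in all other modes, as a function of `ψ`: `|j⟩ ↦ |j⟩ₓ`. -/
def inMode {ι : Type*} (x : ι) : Mode →L[ℂ] Fock ι :=
  basisIncl ⟨fun j => Finsupp.single x j, Finsupp.single_injective x⟩

section Protocol

variable {D : Type*} [Fintype D] [DecidableEq D]

/-- Mode matrix of the beamsplitter acting on the detector mode `d₀` and the output mode:
`a_{d₀}† ↦ √(1-η) a_{d₀}† + i√η a_out†`, `a_out† ↦ i√η a_{d₀}† + √(1-η) a_out†`,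
all the other modes being left alone. -/
def splitterMatrix (d₀ : D) (η : ℝ) : Matrix (D ⊕ Unit) (D ⊕ Unit) ℂ :=
  Matrix.fromBlocks
    (Matrix.diagonal fun d => if d = d₀ then (√(1 - η) : ℂ) else 1)
    (Matrix.of fun d _ => if d = d₀ then Complex.I * (√η : ℂ) else 0)
    (Matrix.of fun _ d => if d = d₀ then Complex.I * (√η : ℂ) else 0)
    (Matrix.of fun _ _ => (√(1 - η) : ℂ))

theorem splitterMatrix_mem (d₀ : D) (η : unitInterval) :
    splitterMatrix d₀ (η : ℝ) ∈ Matrix.unitaryGroup (D ⊕ Unit) ℂ := by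
  have h1 : (√(1 - (η : ℝ)) : ℂ) * (√(1 - (η : ℝ)) : ℂ) = 1 - (η : ℝ) := by
    rw [← Complex.ofReal_mul, Real.mul_self_sqrt (by linarith [η.2.2])]
    push_cast; rfl
  have h2 : (√(η : ℝ) : ℂ) * (√(η : ℝ) : ℂ) = (η : ℝ) := by
    rw [← Complex.ofReal_mul, Real.mul_self_sqrt η.2.1]
  have hI : Complex.I * Complex.I = -1 := Complex.I_mul_I
  rw [Matrix.mem_unitaryGroup_iff']
  ext a b
  rw [Matrix.mul_apply, Fintype.sum_sum_type]
  rcases a with a | a <;> rcases b with b | b <;>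
    simp only [splitterMatrix, Matrix.star_apply, Matrix.fromBlocks_apply₁₁,
      Matrix.fromBlocks_apply₁₂, Matrix.fromBlocks_apply₂₁, Matrix.fromBlocks_apply₂₂,
      Matrix.diagonal_apply, Matrix.of_apply, Matrix.one_apply, apply_ite star, star_zero,
      star_one, star_mul', RCLike.star_def, Complex.conj_I, Complex.conj_ofReal, ite_mul, mul_ite,
      zero_mul, mul_zero, one_mul, mul_one, Finset.sum_ite_eq',
      Finset.mem_univ, if_true, Finset.univ_unique, Finset.sum_singleton, Sum.inl.injEq,
      reduceCtorEq, if_false]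
  · rcases eq_or_ne a d₀ with rfl | ha
    · rcases eq_or_ne b a with rfl | hb
      · simp
        linear_combination h1 + h2 - (√(η : ℝ) : ℂ) * (√(η : ℝ) : ℂ) * hI
      · simp [hb, hb.symm]
    · rcases eq_or_ne a b with rfl | hb
      · simp [ha]
      · simp [ha, hb, hb.symm]
  · rcases eq_or_ne a d₀ with rfl | ha
    · simp
      ring
    · simp [ha, ha.symm]
  · rcases eq_or_ne b d₀ with rfl | hb
    · simp
      ring
    · simp [hb]
  · simp
    linear_combination h1 + h2 - (√(η : ℝ) : ℂ) * (√(η : ℝ) : ℂ) * hI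

/-- The mode matrix `W ⊕ 1`: a network acting on the detector modes only. -/
theorem detectorMatrix_mem (W : Matrix.unitaryGroup D ℂ) :
    Matrix.fromBlocks (W : Matrix D D ℂ) 0 0 (1 : Matrix Unit Unit ℂ) ∈
      Matrix.unitaryGroup (D ⊕ Unit) ℂ := by
  rw [Matrix.mem_unitaryGroup_iff, Matrix.star_eq_conjTranspose, Matrix.fromBlocks_conjTranspose,
    Matrix.fromBlocks_multiply]
  have := Matrix.mem_unitaryGroup_iff.1 W.2
  rw [Matrix.star_eq_conjTranspose] at this
  simp [this]

/-- The state before detection: the squeezed vacuum enters at `d₀`, all other modes are vacuum,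
and the beamsplitter acts on `d₀` and the output mode, so that a portion `η` of the light goes to
the output. -/
def splitState (d₀ : D) (r : ℝ) (η : unitInterval) : Fock (D ⊕ Unit) :=
  linearOptics ⟨splitterMatrix d₀ η, splitterMatrix_mem d₀ η⟩
    (inMode (Sum.inl d₀) (squeezedVacuum r))

/-- The state after the multiport network `W` has distributed the light over all detector
modes. -/
def distributedState (W : Matrix.unitaryGroup D ℂ) (d₀ : D) (r : ℝ) (η : unitInterval) :
    Fock (D ⊕ Unit) :=
  linearOptics ⟨_, detectorMatrix_mem W⟩ (splitState d₀ r η)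

/-- The projector onto "exactly `k` of the ON-OFF detectors click": the sum over the sets `S` of
`k` detectors of the projectors `⨂_{d ∈ S} (1 - |0⟩⟨0|) ⊗ ⨂_{d ∉ S} |0⟩⟨0| ⊗ 1_out`. -/
def clickProj (D : Type*) [Fintype D] (k : ℕ) : Fock (D ⊕ Unit) →L[ℂ] Fock (D ⊕ Unit) :=
  ∑ S ∈ Finset.powersetCard k (Finset.univ : Finset D),
    diagProj {m | ∀ d, m (Sum.inl d) ≠ 0 ↔ d ∈ S}

/-- The isometry `|c⟩ ⊗ 1 : |j⟩ ↦ |c⟩|j⟩`, for a number state `|c⟩` of the detector modes. -/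
def detectorKet (c : D →₀ ℕ) : Mode →L[ℂ] Fock (D ⊕ Unit) :=
  basisIncl ⟨fun j => Finsupp.sumElim c (Finsupp.single () j), fun j j' h => by
    simpa [Finsupp.sumElim_inr] using DFunLike.congr_fun h (Sum.inr ())⟩

/-- The partial trace over the detector modes, `∑_c (⟨c| ⊗ 1) T (|c⟩ ⊗ 1)`. -/
def traceDetectors (T : Fock (D ⊕ Unit) →L[ℂ] Fock (D ⊕ Unit)) : Mode →L[ℂ] Mode :=
  ∑' c : D →₀ ℕ, adjoint (detectorKet c) ∘L T ∘L detectorKet c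

/-- The probability that exactly `k` of the ON-OFF detectors click. -/
def clickProb (W : Matrix.unitaryGroup D ℂ) (d₀ : D) (r : ℝ) (η : unitInterval) (k : ℕ) : ℝ :=
  (inner ℂ (distributedState W d₀ r η) (clickProj D k (distributedState W d₀ r η))).re

/-- The normalised state of the output mode, conditioned on exactly `k` clicks. -/
def heraldedState (W : Matrix.unitaryGroup D ℂ) (d₀ : D) (r : ℝ) (η : unitInterval) (k : ℕ) :
    Mode →L[ℂ] Mode :=
  ((clickProb W d₀ r η k : ℂ)⁻¹) •
    traceDetectors (clickProj D k ∘L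
      rankOne ℂ (distributedState W d₀ r η) (distributedState W d₀ r η) ∘L clickProj D k)

/-- The fidelity of the heralded state with the even cat state of amplitude `√k`. -/
def fidelityMPNR (W : Matrix.unitaryGroup D ℂ) (d₀ : D) (r : ℝ) (η : unitInterval) (k : ℕ) : ℝ :=
  (inner ℂ (evenCat (√(k : ℝ) : ℂ)) (heraldedState W d₀ r η k (evenCat (√(k : ℝ) : ℂ)))).re

end Protocol

/-- The unnormalised output `(⟨k| ⊗ 1) |Ψ⟩` when a single detector mode is measured by an ideal
photon-number-resolving detector with outcome `k`. -/
def pnrVector (r : ℝ) (η : unitInterval) (k : ℕ) : Mode :=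
  adjoint (detectorKet (Finsupp.single () k)) (splitState () r η)

/-- The probability of the outcome `k` of the ideal detector. -/
def pnrProb (r : ℝ) (η : unitInterval) (k : ℕ) : ℝ := ‖pnrVector r η k‖ ^ 2

/-- The normalised output state for the outcome `k` of the ideal detector. -/
def pnrState (r : ℝ) (η : unitInterval) (k : ℕ) : Mode :=
  ((‖pnrVector r η k‖ : ℂ)⁻¹) • pnrVector r η k

/-- The fidelity of the ideally heralded state with the even cat state of amplitude `√k`. -/
def fidelityPNR (r : ℝ) (η : unitInterval) (k : ℕ) : ℝ :=
  ‖inner ℂ (evenCat (√(k : ℝ) : ℂ)) (pnrState r η k)‖ ^ 2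

/-- The integrand of the coherent-state representation of the heralded state: at `(α, β)`,
`(cosh r)⁻¹ exp(-tanh r (α*)²/2 - |α|²/2) exp(-tanh r β²/2 - |β|²/2)
  exp(-(1-η)(|α|²+|β|²)/2) {exp((1-η) α β* / n) - 1}^k |√η i α⟩⟨√η i β|`. -/
def heraldIntegrand (r η : ℝ) (n k : ℕ) (z : ℂ × ℂ) : Mode →L[ℂ] Mode :=
  ((1 / Real.cosh r : ℝ) *
      Complex.exp (-(Real.tanh r : ℂ) * conj z.1 ^ 2 / 2) * Complex.exp (-(‖z.1‖ : ℂ) ^ 2 / 2) *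
      Complex.exp (-(Real.tanh r : ℂ) * z.2 ^ 2 / 2) * Complex.exp (-(‖z.2‖ : ℂ) ^ 2 / 2) *
      Complex.exp (-((1 - η : ℝ) * ((‖z.1‖ : ℂ) ^ 2 + (‖z.2‖ : ℂ) ^ 2)) / 2) *
      (Complex.exp ((1 - η : ℝ) * z.1 * conj z.2 / n) - 1) ^ k) •
    rankOne ℂ (coherent (√η * Complex.I * z.1)) (coherent (√η * Complex.I * z.2))

end CatBreeding

end

open scoped ComplexConjugate lp

noncomputable section

namespace CatBreeding

open MvPolynomial InnerProductSpace ContinuousLinearMap MeasureTheory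

/-! ### The power series `(e^x - 1)^k` -/

/-! Write `x = (1 - η)/n`, `τ = |tanh r|`, `w_N = outVector r η N`, and let `s(k,N)` be the
coefficient of `t^N` in `(e^t - 1)^k`. Both sides of the integral formula equal `C(n,k) ∑_N s(k,N)
x^N |w_N⟩⟨w_N|`.

Optical side: all light enters through one port and photon number is conserved, so the amplitude of
a detector pattern `c` together with `j` output photons is a factor depending on `c` times the
`j`-th amplitude of `w_N`, where `N = ∑ c_d` (`distributedState_apply`). For a balanced network the
squared modulus of that factor is `x^N ∏ 1/c_d!`. Summed over the patterns of `N` photons with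
exactly `k` occupied detectors it gives `C(n,k) s(k,N) x^N` (`sum_inv_factorial_eq`).

Integral side: expand `(e^{xαβ*} - 1)^k` in powers of `αβ*`. Each term separates into an
`α`-integral and a conjugate `β`-integral, and orthogonality of monomials under the Gaussian turns
these into the amplitudes of `π w_N` (`integral_kernelWeight_mul_coherent`).

Convergence rests on `s(k,N) ≤ k^N/N!` and `‖w_N‖² ≤ N! τ^N/(1 - τη)^(N+1)`. Since `k ≤ n` and `1 -
η ≤ 1 - τη`, the terms are at most a constant times `τ^N` (`surjCoeff_mul_norm_sq_le`).

Fidelity: `s(k,N) = 0` for `N < k` and `s(k,k) = 1`, so the leading term is `|w_k⟩⟨w_k|`, which is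
the ideal outcome. The remainder is smaller by a factor `x`, uniformly as long as `‖w_k‖` stays away
from zero (`exists_pos_le_norm_sq_outVector`). -/

/-- The coefficient of `x^N` in `(e^x - 1)^k`. -/
def surjCoeff (k N : ℕ) : ℝ := PowerSeries.coeff N ((PowerSeries.exp ℝ - 1) ^ k)

theorem coeff_exp_pow (j N : ℕ) :
    PowerSeries.coeff N (PowerSeries.exp ℝ ^ j) = (j : ℝ) ^ N / N.factorial := by
  rw [PowerSeries.exp_pow_eq_rescale_exp, PowerSeries.coeff_rescale, PowerSeries.coeff_exp]
  simp [div_eq_mul_inv]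

theorem coeff_exp_sub_one (N : ℕ) :
    PowerSeries.coeff N (PowerSeries.exp ℝ - 1) = if N = 0 then 0 else (N.factorial : ℝ)⁻¹ := by
  rw [map_sub, PowerSeries.coeff_exp, PowerSeries.coeff_one]
  split_ifs with h
  · simp [h]
  · simp

theorem coeff_pow_nonneg {f : PowerSeries ℝ} (hf : ∀ N, 0 ≤ PowerSeries.coeff N f) (k N : ℕ) :
    0 ≤ PowerSeries.coeff N (f ^ k) := by
  rw [PowerSeries.coeff_pow]
  exact Finset.sum_nonneg fun _ _ => Finset.prod_nonneg fun _ _ => hf _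

theorem surjCoeff_nonneg (k N : ℕ) : 0 ≤ surjCoeff k N :=
  coeff_pow_nonneg (fun N => by rw [coeff_exp_sub_one]; positivity) k N

/-- Expand `exp^k = ((exp - 1) + 1)^k`: every term has nonnegative coefficients, and the top one is
`(exp - 1)^k`. The factor `1/N!` is what later cancels the factorial growth of `‖outVector r η N‖²`.
-/
theorem surjCoeff_le (k N : ℕ) : surjCoeff k N ≤ (k : ℝ) ^ N / N.factorial := by
  rw [← coeff_exp_pow, ← sub_add_cancel (PowerSeries.exp ℝ) 1, add_pow, map_sum]
  have h : ∀ j, PowerSeries.coeff N ((PowerSeries.exp ℝ - 1) ^ j * 1 ^ (k - j) *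
      (k.choose j : PowerSeries ℝ)) =
      surjCoeff j N * k.choose j := by
    intro j
    rw [one_pow, mul_one, ← map_natCast (PowerSeries.C (R := ℝ)), PowerSeries.coeff_mul_C]
    rfl
  simp only [h]
  calc surjCoeff k N = surjCoeff k N * k.choose k := by simp
    _ ≤ _ := Finset.single_le_sum (f := fun j => surjCoeff j N * (k.choose j : ℝ))
      (fun j _ => mul_nonneg (surjCoeff_nonneg j N) (by positivity)) (by simp)

theorem exists_exp_sub_one_eq_X_mul :
    ∃ g : PowerSeries ℝ, PowerSeries.exp ℝ - 1 = PowerSeries.X * g ∧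
      PowerSeries.constantCoeff g = 1 := by
  obtain ⟨g, hg⟩ := PowerSeries.X_dvd_iff.2
    (show PowerSeries.constantCoeff (PowerSeries.exp ℝ - 1) = 0 by simp)
  refine ⟨g, hg, ?_⟩
  have h := coeff_exp_sub_one 1
  rw [hg, PowerSeries.coeff_succ_X_mul] at h
  simpa using h

theorem surjCoeff_of_lt {k N : ℕ} (h : N < k) : surjCoeff k N = 0 := by
  obtain ⟨g, hg, -⟩ := exists_exp_sub_one_eq_X_mul
  rw [surjCoeff, hg, mul_pow, PowerSeries.coeff_X_pow_mul', if_neg (by omega)]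

theorem surjCoeff_self (k : ℕ) : surjCoeff k k = 1 := by
  obtain ⟨g, hg, h1⟩ := exists_exp_sub_one_eq_X_mul
  rw [surjCoeff, hg, mul_pow, PowerSeries.coeff_X_pow_mul', if_pos le_rfl, Nat.sub_self]
  simp [h1]

theorem surjCoeff_eq_sum (k N : ℕ) : surjCoeff k N =
    ∑ j ∈ Finset.range (k + 1), (-1) ^ (k - j) * (k.choose j : ℝ) * ((j : ℝ) ^ N / N.factorial) := by
  rw [surjCoeff, sub_eq_add_neg, add_pow, map_sum]
  refine Finset.sum_congr rfl fun j _ => ?_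
  have : ((-1 : PowerSeries ℝ) ^ (k - j)) * (k.choose j : PowerSeries ℝ) =
      PowerSeries.C ((-1 : ℝ) ^ (k - j) * (k.choose j : ℝ)) := by simp
  rw [mul_assoc, this, PowerSeries.coeff_mul_C, coeff_exp_pow, mul_comm]

/-- The binomial theorem reduces the claim to a finite combination of exponential series, so no
product of infinite series is needed. -/
theorem hasSum_surjCoeff (k : ℕ) (z : ℂ) :
    HasSum (fun N => (surjCoeff k N : ℂ) * z ^ N) ((Complex.exp z - 1) ^ k) := by
  have h : ∀ j : ℕ, HasSum (fun N : ℕ => (-1) ^ (k - j) * (k.choose j : ℂ) *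
      ((j * z) ^ N / N.factorial)) ((-1) ^ (k - j) * (k.choose j : ℂ) * Complex.exp (j * z)) := by
    intro j
    rw [Complex.exp_eq_exp_ℂ]
    exact (NormedSpace.expSeries_div_hasSum_exp (j * z)).mul_left _
  convert hasSum_sum (s := Finset.range (k + 1)) fun j _ => h j using 1
  · funext N
    rw [surjCoeff_eq_sum, Complex.ofReal_sum, Finset.sum_mul]
    refine Finset.sum_congr rfl fun j _ => ?_
    push_cast
    rw [mul_pow]
    ring
  · rw [sub_eq_add_neg, add_pow]
    refine Finset.sum_congr rfl fun j _ => ?_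
    rw [Complex.exp_nat_mul]
    ring

theorem hasSum_surjCoeff_real (k : ℕ) (x : ℝ) :
    HasSum (fun N => surjCoeff k N * x ^ N) ((Real.exp x - 1) ^ k) := by
  have := hasSum_surjCoeff k x
  rw [← Complex.hasSum_ofReal]
  push_cast
  exact this

/-- The sum of `1 / ∏ c_d!` over the occupation patterns of `N` photons with exactly `k` occupied
modes. -/
theorem sum_inv_factorial_eq {D : Type*} [Fintype D] [DecidableEq D] (k N : ℕ) :
    ∑ c ∈ Finset.finsuppAntidiag (Finset.univ : Finset D) N,
      (if c.support.card = k then (∏ d, ((c d).factorial : ℝ))⁻¹ else 0) =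
      ((Fintype.card D).choose k : ℝ) * surjCoeff k N := by
  have h : ∀ S : Finset D, S.card = k → surjCoeff k N =
      ∑ c ∈ Finset.finsuppAntidiag (Finset.univ : Finset D) N,
        if c.support = S then (∏ d, ((c d).factorial : ℝ))⁻¹ else 0 := by
    intro S hS
    -- With factor `exp - 1` at the modes of `S` and factor `1` elsewhere, the coefficient of a
    -- product keeps exactly the patterns whose support is `S`.
    have h1 : (PowerSeries.exp ℝ - 1) ^ k =
        ∏ d : D, if d ∈ S then PowerSeries.exp ℝ - 1 else 1 := by
      rw [Finset.prod_ite_mem, Finset.univ_inter, Finset.prod_const, hS]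
    rw [surjCoeff, h1, PowerSeries.coeff_prod]
    refine Finset.sum_congr rfl fun c _ => ?_
    split_ifs with hc
    · rw [← Finset.prod_inv_distrib]
      refine Finset.prod_congr rfl fun d _ => ?_
      subst hc
      split_ifs with hd
      · rw [coeff_exp_sub_one, if_neg (Finsupp.mem_support_iff.1 hd)]
      · simp [Finsupp.notMem_support_iff.1 hd]
    · obtain ⟨d, hd⟩ : ∃ d, ¬ (d ∈ c.support ↔ d ∈ S) := by
        by_contra! hcon
        exact hc (Finset.ext hcon)
      refine Finset.prod_eq_zero (Finset.mem_univ d) ?_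
      rw [Finsupp.mem_support_iff] at hd
      by_cases h2 : d ∈ S
      · have : c d = 0 := by tauto
        rw [if_pos h2, this, coeff_exp_sub_one, if_pos rfl]
      · have : c d ≠ 0 := by tauto
        rw [if_neg h2, PowerSeries.coeff_one, if_neg this]
  have h2 : ∀ c : D →₀ ℕ, (if c.support.card = k then (∏ d, ((c d).factorial : ℝ))⁻¹ else 0) =
      ∑ S ∈ Finset.powersetCard k (Finset.univ : Finset D),
        if c.support = S then (∏ d, ((c d).factorial : ℝ))⁻¹ else 0 := by
    intro c
    rw [Finset.sum_ite_eq]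
    simp [Finset.mem_powersetCard]
  simp only [h2]
  rw [Finset.sum_comm, ← Finset.sum_congr rfl fun S hS => h S (Finset.mem_powersetCard.1 hS).2]
  simp

/-- Summing over occupation patterns by the total number of photons. -/
theorem hasSum_of_card_support {D E : Type*} [Fintype D] [NormedAddCommGroup E]
    [NormedSpace ℝ E] [CompleteSpace E] (k : ℕ) (f : ℕ → E)
    (hf : Summable fun N => surjCoeff k N * ‖f N‖) :
    HasSum (fun c : D →₀ ℕ =>
      (if c.support.card = k then (∏ d, ((c d).factorial : ℝ))⁻¹ else 0) • f (∑ d, c d))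
      (∑' N, (((Fintype.card D).choose k : ℝ) * surjCoeff k N) • f N) := by
  classical
  set g : (D →₀ ℕ) → ℝ := fun c =>
    if c.support.card = k then (∏ d, ((c d).factorial : ℝ))⁻¹ else 0
  have hg : ∀ c, 0 ≤ g c := fun c => by
    simp only [g]
    split_ifs <;> positivity
  let deg : (D →₀ ℕ) → ℕ := fun c => ∑ d, c d
  have hsum : ∀ (N : ℕ) (u : (D →₀ ℕ) → ℝ), HasSum (fun c : {c // deg c = N} => u c)
      (∑ c ∈ Finset.finsuppAntidiag (Finset.univ : Finset D) N, u c) := by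
    intro N u
    let e : {c // deg c = N} ≃ (Finset.finsuppAntidiag (Finset.univ : Finset D) N : Set _) :=
      Equiv.subtypeEquivRight fun c => by simp [Finset.mem_finsuppAntidiag, deg]
    have h1 := Finset.hasSum (Finset.finsuppAntidiag (Finset.univ : Finset D) N) u
    exact e.hasSum_iff.2 h1
  have hA : ∀ N, HasSum (fun c : {c // deg c = N} => g c)
      (((Fintype.card D).choose k : ℝ) * surjCoeff k N) := by
    intro N
    rw [← sum_inv_factorial_eq]
    exact hsum N g
  let e := Equiv.sigmaFiberEquiv deg
  have hval : ∀ N (c : {c // deg c = N}), f (deg (e ⟨N, c⟩)) = f N := fun N c => congrArg f c.2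
  -- The fibres of `deg` are finite and `f ∘ deg` is constant on each, so the sum of norms over a
  -- fibre is known exactly and the hypothesis on `N` gives absolute summability over patterns.
  have hs : Summable (fun c => g c • f (deg c)) := by
    refine Summable.of_norm (e.summable_iff.1 ?_)
    refine (summable_sigma_of_nonneg (fun _ => norm_nonneg _)).2 ?_
    have h3 : ∀ N, HasSum (fun c : {c // deg c = N} => ‖g (e ⟨N, c⟩) • f (deg (e ⟨N, c⟩))‖)
        (((Fintype.card D).choose k : ℝ) * surjCoeff k N * ‖f N‖) := by
      intro N
      simp only [hval, norm_smul, Real.norm_of_nonneg (hg _)]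
      exact (hA N).mul_right ‖f N‖
    refine ⟨fun N => (h3 N).summable, ?_⟩
    refine (hf.mul_left ((Fintype.card D).choose k : ℝ)).congr fun N => ?_
    rw [← mul_assoc]
    exact (h3 N).tsum_eq.symm
  have h4 := (e.summable_iff.2 hs).hasSum.sigma (g := fun N =>
    (((Fintype.card D).choose k : ℝ) * surjCoeff k N) • f N) (fun N => by
      simp only [Function.comp, hval]
      exact (hA N).smul_const (f N))
  rw [h4.tsum_eq]
  exact (e.hasSum_iff.1 (e.summable_iff.2 hs).hasSum)

/-! ### Expansions in the number basis -/

theorem hasSum_ket {κ : Type*} (ψ : ℓ²(κ, ℂ)) : HasSum (fun m => ψ m • ket m) ψ := by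
  classical
  have h : ∀ m, ψ m • (ket m : ℓ²(κ, ℂ)) = lp.single 2 m (ψ m) := by
    intro m
    ext j
    rw [lp.coeFn_smul, Pi.smul_apply, ket_apply, lp.single_apply, Pi.single_apply]
    by_cases hj : j = m
    · subst hj; simp
    · simp [hj]
  simp only [h]
  exact lp.hasSum_single (by norm_num) ψ

theorem clm_ext_ket {κ E : Type*} [NormedAddCommGroup E] [NormedSpace ℂ E]
    {A B : ℓ²(κ, ℂ) →L[ℂ] E} (h : ∀ m, A (ket m) = B (ket m)) : A = B := by
  ext ψ : 1
  have h1 := (hasSum_ket ψ).mapL A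
  have h2 := (hasSum_ket ψ).mapL B
  simp only [map_smul, h] at h1 h2
  exact h1.unique h2

theorem hasSum_norm_sq {κ : Type*} (ψ : ℓ²(κ, ℂ)) : HasSum (fun m => ‖ψ m‖ ^ 2) (‖ψ‖ ^ 2) := by
  have := lp.hasSum_norm (p := 2) (by norm_num) ψ
  simpa using this

theorem hasSum_apply {κ ι : Type*} {f : ι → ℓ²(κ, ℂ)} {ψ : ℓ²(κ, ℂ)} (h : HasSum f ψ) (m : κ) :
    HasSum (fun i => f i m) (ψ m) := by
  have := h.mapL (innerSL ℂ (ket m))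
  simpa only [innerSL_apply_apply, inner_ket] using this

theorem isometry_ext_ket {κ E : Type*} [NormedAddCommGroup E] [NormedSpace ℂ E]
    {A B : ℓ²(κ, ℂ) →ₗᵢ[ℂ] E} (h : ∀ m, A (ket m) = B (ket m)) : A = B := by
  have := clm_ext_ket (A := A.toContinuousLinearMap) (B := B.toContinuousLinearMap) h
  ext ψ : 1
  exact congrArg (fun T : ℓ²(κ, ℂ) →L[ℂ] E => T ψ) this

theorem adjoint_diagProj {κ : Type*} (s : Set κ) : adjoint (diagProj s) = diagProj s := by
  rw [diagProj, adjoint_comp, adjoint_adjoint]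

/-! ### Composition of linear-optical networks -/

section LinearOptics

variable {ι : Type*} [Fintype ι]

theorem transformedKet_eq_creation (U : Matrix ι ι ℂ) (m : ι →₀ ℕ) :
    transformedKet U m = creation (substitute U
      (monomial m ((√(∏ i, ((m i).factorial : ℝ)) : ℂ)⁻¹))) := by
  rw [transformedKet, ← map_smul, substitute, aeval_monomial, MvPolynomial.smul_eq_C_mul,
    Finsupp.prod_fintype _ _ (by simp)]
  rfl

variable [DecidableEq ι] in
theorem linearOptics_ket (U : Matrix.unitaryGroup ι ℂ) (m : ι →₀ ℕ) :
    linearOptics U (ket m) = transformedKet (U : Matrix ι ι ℂ) m :=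
  basisIsometry_ket _ _ _

variable [DecidableEq ι] in
theorem linearOptics_creation (U : Matrix.unitaryGroup ι ℂ) (p : MvPolynomial ι ℂ) :
    linearOptics U (creation p) = creation (substitute (U : Matrix ι ι ℂ) p) := by
  induction p using MvPolynomial.induction_on' with
  | monomial m c =>
    rw [creation_monomial, map_smul, linearOptics_ket, transformedKet_eq_creation, ← map_smul,
      ← map_smul, smul_monomial, smul_eq_mul, mul_assoc, mul_inv_cancel₀ (sqrt_fact_ne_zero m),
      mul_one]
  | add p q hp hq => simp only [map_add, hp, hq]

theorem substitute_substitute (U V : Matrix ι ι ℂ) (p : MvPolynomial ι ℂ) :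
    substitute V (substitute U p) = substitute (V * U) p := by
  have : (substitute V).comp (substitute U) = substitute (V * U) := by
    apply MvPolynomial.algHom_ext
    intro i
    simp only [substitute, AlgHom.comp_apply, aeval_X, map_sum, map_mul, algHom_C,
      MvPolynomial.algebraMap_eq, Matrix.mul_apply, Finset.mul_sum, Finset.sum_mul]
    rw [Finset.sum_comm]
    refine Finset.sum_congr rfl fun l _ => Finset.sum_congr rfl fun j _ => by ring
  rw [← this]
  rfl

variable [DecidableEq ι] in
-- This merges the beamsplitter and the multiport into one network, of which only the column of the
-- input port matters.
theorem linearOptics_linearOptics (U V : Matrix.unitaryGroup ι ℂ) (ψ : Fock ι) :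
    linearOptics V (linearOptics U ψ) = linearOptics (V * U) ψ := by
  have : (linearOptics V).comp (linearOptics U) = linearOptics (V * U) := by
    apply isometry_ext_ket
    intro m
    rw [LinearIsometry.coe_comp, Function.comp_apply, linearOptics_ket, linearOptics_ket, transformedKet_eq_creation,
      linearOptics_creation, substitute_substitute, transformedKet_eq_creation]
    rfl
  rw [← this]
  rfl

/-- The multinomial coefficient `j!/∏ (m l)!` meets the normalisation `√(∏ (m l)!)`, which leaves
one square root per mode in the denominator. -/
theorem creation_sum_pow_apply (y : ι → ℂ) (j : ℕ) (m : ι →₀ ℕ) :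
    creation ((∑ l, C (y l) * X l) ^ j) m = if ∑ l, m l = j then
      (j.factorial : ℂ) * ∏ l, (y l ^ m l / (√((m l).factorial : ℝ) : ℂ)) else 0 := by
  have h : ∑ l, C (y l) * X l = ∑ l, y l • (X l : MvPolynomial ι ℂ) := by
    simp only [MvPolynomial.smul_eq_C_mul]
  have hs : (m.sum fun _ n => n) = ∑ l, m l := Finsupp.sum_fintype _ _ (by simp)
  rw [creation_apply, h, coeff_linearCombination_X_pow_of_fintype, hs, mul_ite, mul_zero]
  split_ifs with hj
  · have h1 : (∏ l, ((m l).factorial : ℂ)) * (m.multinomial : ℂ) = j.factorial := by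
      have : (∏ l, (m l).factorial) * m.multinomial = j.factorial := by
        have h5 := Nat.multinomial_spec Finset.univ m
        rwa [hj, ← Finsupp.multinomial_eq_of_support_subset (Finset.subset_univ _)] at h5
      rw [← this]
      push_cast
      rfl
    have h2 : ∀ l, (√((m l).factorial : ℝ) : ℂ) ≠ 0 := fun l => by
      exact_mod_cast (Real.sqrt_pos.2 (by positivity)).ne'
    have h3 : ∀ l, (√((m l).factorial : ℝ) : ℂ) * √((m l).factorial : ℝ) = (m l).factorial := by
      intro l
      rw [← Complex.ofReal_mul, Real.mul_self_sqrt (by positivity)]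
      simp
    rw [← h1, Real.sqrt_prod _ (fun _ _ => by positivity), Finsupp.prod_fintype _ _ (by simp),
      Finset.prod_div_distrib, ← Finset.prod_congr rfl fun l _ => h3 l, Finset.prod_mul_distrib]
    have := Finset.prod_ne_zero_iff.2 fun l (_ : l ∈ Finset.univ) => h2 l
    push_cast
    field_simp
  · rfl

end LinearOptics

/-! ### Amplitudes of the optical states -/

/-- `√(j!)` times the amplitude of `|j⟩` in the squeezed vacuum: the Taylor coefficients of
`(cosh r)^{-1/2} exp(-tanh r x² / 2)`, times `j!`. -/
def squeezedCoeff (r : ℝ) (j : ℕ) : ℝ := squeezedAmp r j * √(j.factorial : ℝ)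

/-- Photon number is conserved, so among the components `|j⟩` of the squeezed vacuum only `j = ∑ m
l` reaches the basis vector `m`. -/
theorem linearOptics_inMode_apply {ι : Type*} [Fintype ι] [DecidableEq ι]
    (U : Matrix.unitaryGroup ι ℂ) (x : ι) (r : ℝ) (m : ι →₀ ℕ) :
    linearOptics U (inMode x (squeezedVacuum r)) m = (squeezedCoeff r (∑ l, m l) : ℂ) *
      ∏ l, ((U : Matrix ι ι ℂ) l x ^ m l / (√((m l).factorial : ℝ) : ℂ)) := by
  have hket : ∀ j, inMode x (ket j) = ket (Finsupp.single x j) :=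
    fun j => basisIsometry_ket _ (orthonormal_ket.comp _ (Finsupp.single_injective x)) j
  have h1 := hasSum_apply
    (((hasSum_ket (squeezedVacuum r)).mapL (inMode x)).mapL
      (linearOptics U).toContinuousLinearMap) m
  have h2 : ∀ j, (linearOptics U).toContinuousLinearMap
      (inMode x (squeezedVacuum r j • ket j)) m = if ∑ l, m l = j then
      (squeezedCoeff r j : ℂ) * ∏ l, ((U : Matrix ι ι ℂ) l x ^ m l / (√((m l).factorial : ℝ) : ℂ))
      else 0 := by
    intro j
    have h3 : ∏ i, (∑ l, C ((U : Matrix ι ι ℂ) l i) * X l) ^ (Finsupp.single x j) i =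
        (∑ l, C ((U : Matrix ι ι ℂ) l x) * X l : MvPolynomial ι ℂ) ^ j := by
      rw [Finset.prod_eq_single x]
      · simp
      · intro b _ hb
        simp [hb.symm]
      · simp
    have h4 : ∏ i, (((Finsupp.single x j) i).factorial : ℝ) = j.factorial := by
      rw [Finset.prod_eq_single x]
      · simp
      · intro b _ hb
        simp [hb.symm]
      · simp
    rw [map_smul, hket, map_smul, LinearIsometry.coe_toContinuousLinearMap, linearOptics_ket,
      transformedKet, h3, h4, lp.coeFn_smul, lp.coeFn_smul, Pi.smul_apply, Pi.smul_apply,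
      creation_sum_pow_apply]
    split_ifs with hj
    · have h5 : (√(j.factorial : ℝ) : ℂ) ≠ 0 := by
        exact_mod_cast (Real.sqrt_pos.2 (by positivity)).ne'
      have h6 : (√(j.factorial : ℝ) : ℂ) * √(j.factorial : ℝ) = j.factorial := by
        rw [← Complex.ofReal_mul, Real.mul_self_sqrt (by positivity)]
        simp
      rw [← h6, squeezedCoeff, smul_eq_mul, smul_eq_mul]
      change (squeezedAmp r j : ℂ) * _ = _
      push_cast
      field_simp
    · simp
  simp only [h2] at h1
  have h7 := h1.tsum_eq
  rw [tsum_ite_eq'] at h7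
  exact h7.symm

theorem splitState_apply {D : Type*} [Fintype D] [DecidableEq D] (d₀ : D) (r : ℝ)
    (η : unitInterval) (m : D ⊕ Unit →₀ ℕ) :
    splitState d₀ r η m = (squeezedCoeff r (∑ l, m l) : ℂ) *
      ∏ l, (splitterMatrix d₀ η l (Sum.inl d₀) ^ m l / (√((m l).factorial : ℝ) : ℂ)) :=
  linearOptics_inMode_apply _ _ _ _

/-- The factorisation behind everything else: the last bracket, which carries all dependence on `j`,
sees the pattern `c` only through its total photon number. -/
theorem distributedState_apply {D : Type*} [Fintype D] [DecidableEq D]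
    (W : Matrix.unitaryGroup D ℂ) (d₀ : D) (r : ℝ) (η : unitInterval) (c : D →₀ ℕ) (j : ℕ) :
    distributedState W d₀ r η (Finsupp.sumElim c (Finsupp.single () j)) =
      (∏ d, ((W : Matrix D D ℂ) d d₀ ^ c d / (√((c d).factorial : ℝ) : ℂ))) *
      ((√(1 - η : ℝ) : ℂ) ^ (∑ d, c d) * ((squeezedCoeff r (∑ d, c d + j) : ℂ) *
        ((Complex.I * (√(η : ℝ) : ℂ)) ^ j / (√(j.factorial : ℝ) : ℂ)))) := by
  have hM : ∀ l, (Matrix.fromBlocks (W : Matrix D D ℂ) 0 0 (1 : Matrix Unit Unit ℂ) *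
      splitterMatrix d₀ η) l (Sum.inl d₀) = Sum.elim
        (fun d => (W : Matrix D D ℂ) d d₀ * (√(1 - η : ℝ) : ℂ))
        (fun _ => Complex.I * (√(η : ℝ) : ℂ)) l := by
    intro l
    rw [splitterMatrix, Matrix.fromBlocks_multiply]
    rcases l with d | u
    · simp [Matrix.mul_apply, Matrix.diagonal_apply]
    · simp
  rw [distributedState, splitState, linearOptics_linearOptics, linearOptics_inMode_apply,
    Submonoid.coe_mul]
  simp only [hM, Fintype.sum_sum_type, Fintype.prod_sum_type, Sum.elim_inl, Sum.elim_inr,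
    Finsupp.sumElim_inl, Finsupp.sumElim_inr, Finset.univ_unique, Finset.sum_singleton,
    Finset.prod_singleton, PUnit.default_eq_unit, Finsupp.single_eq_same, mul_pow, mul_div_right_comm,
    Finset.prod_mul_distrib, Finset.prod_pow_eq_pow_sum]
  ring

theorem pnrVector_apply (r : ℝ) (η : unitInterval) (k j : ℕ) :
    pnrVector r η k j = ((√(1 - η : ℝ) : ℂ) ^ k / (√(k.factorial : ℝ) : ℂ)) *
      ((squeezedCoeff r (k + j) : ℂ) *
        ((Complex.I * (√(η : ℝ) : ℂ)) ^ j / (√(j.factorial : ℝ) : ℂ))) := by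
  have h : pnrVector r η k j = splitState () r η
      (Finsupp.sumElim (Finsupp.single () k) (Finsupp.single () j)) :=
    adjoint_basisIncl_apply _ _ _
  rw [h, splitState_apply]
  simp only [Fintype.sum_sum_type, Fintype.prod_sum_type,
    Finsupp.sumElim_inl, Finsupp.sumElim_inr, Finset.univ_unique, Finset.sum_singleton,
    Finset.prod_singleton, PUnit.default_eq_unit, Finsupp.single_eq_same, splitterMatrix,
    Matrix.fromBlocks_apply₁₁, Matrix.fromBlocks_apply₂₁, Matrix.diagonal_apply, if_true,
    Matrix.of_apply]
  ring

/-! ### Bounds on the conditional output vectors -/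

theorem abs_tanh_lt_one (r : ℝ) : |Real.tanh r| < 1 := by
  rw [← sq_lt_one_iff_abs_lt_one, Real.tanh_eq_sinh_div_cosh, div_pow,
    div_lt_one (by positivity), Real.cosh_sq]
  linarith

theorem squeezedCoeff_odd {r : ℝ} {j : ℕ} (h : ¬ Even j) : squeezedCoeff r j = 0 := by
  simp [squeezedCoeff, squeezedAmp, h]

theorem squeezedCoeff_two_mul (r : ℝ) (l : ℕ) : squeezedCoeff r (2 * l) =
    (√(Real.cosh r))⁻¹ * ((-Real.tanh r / 2) ^ l / l.factorial) * (2 * l).factorial := by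
  rw [squeezedCoeff, squeezedAmp, if_pos (even_two_mul l), show 2 * l / 2 = l by omega, div_pow]
  have := Real.mul_self_sqrt (show (0 : ℝ) ≤ ((2 * l).factorial : ℝ) by positivity)
  generalize √((2 * l).factorial : ℝ) = s at this ⊢
  rw [← this]
  field_simp

theorem squeezedCoeff_ne_zero {r : ℝ} {j : ℕ} (hj : Even j) (h : r ≠ 0 ∨ j = 0) :
    squeezedCoeff r j ≠ 0 := by
  obtain ⟨l, rfl⟩ := hj
  have hc : √(Real.cosh r) ≠ 0 := (Real.sqrt_pos.2 (Real.cosh_pos r)).ne'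
  rw [← two_mul, squeezedCoeff_two_mul]
  have h1 : (-Real.tanh r / 2) ^ l ≠ 0 := by
    rcases h with h | h
    · refine pow_ne_zero _ (div_ne_zero (neg_ne_zero.2 ?_) two_ne_zero)
      rw [Real.tanh_eq_sinh_div_cosh]
      exact div_ne_zero (Real.sinh_ne_zero.2 h) (Real.cosh_pos r).ne'
    · have : l = 0 := by omega
      simp [this]
  positivity

theorem squeezedCoeff_zero_left {j : ℕ} (hj : j ≠ 0) : squeezedCoeff 0 j = 0 := by
  by_cases h : Even j
  · obtain ⟨l, rfl⟩ := h
    have : l ≠ 0 := by omega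
    rw [← two_mul, squeezedCoeff_two_mul]
    simp [this]
  · exact squeezedCoeff_odd h

/-- For `j = 2l` the factor `2^(-l)/l!` is compensated by `(2l)! ≤ 4^l (l!)²`, the bound `4^l` on
the central binomial coefficient. -/
theorem squeezedCoeff_sq_le (r : ℝ) (j : ℕ) :
    squeezedCoeff r j ^ 2 ≤ j.factorial * |Real.tanh r| ^ j := by
  by_cases hj : Even j
  swap
  · rw [squeezedCoeff_odd hj, zero_pow two_ne_zero]
    positivity
  obtain ⟨l, rfl⟩ := hj
  rw [← two_mul, squeezedCoeff_two_mul]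
  have hc : (√(Real.cosh r))⁻¹ ^ 2 ≤ 1 := by
    rw [inv_pow, Real.sq_sqrt (Real.cosh_pos r).le]
    exact inv_le_one_of_one_le₀ (Real.one_le_cosh r)
  have h1 : ((2 * l).factorial : ℝ) ≤ 4 ^ l * (l.factorial : ℝ) ^ 2 := by
    have hc : Nat.centralBinom l ≤ 4 ^ l := by
      rw [Nat.centralBinom_eq_two_mul_choose, show (4 : ℕ) = 2 ^ 2 by norm_num, ← pow_mul]
      exact Nat.choose_le_two_pow _ _
    have h2 : (2 * l).factorial = Nat.centralBinom l * l.factorial ^ 2 := by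
      have := Nat.choose_mul_factorial_mul_factorial (show l ≤ 2 * l by omega)
      rw [Nat.centralBinom_eq_two_mul_choose, ← this, show 2 * l - l = l by omega]
      ring
    rw [h2]
    exact_mod_cast Nat.mul_le_mul_right _ hc
  have h3 : (0 : ℝ) < l.factorial := by positivity
  have h4 : ((-Real.tanh r / 2) ^ l / l.factorial) ^ 2 * (2 * l).factorial ≤
      |Real.tanh r| ^ (2 * l) := by
    rw [div_pow, div_mul_eq_mul_div, div_le_iff₀ (by positivity), ← pow_mul, mul_comm l 2, pow_mul,
      div_pow, neg_sq, pow_mul, sq_abs, div_pow, div_mul_eq_mul_div, div_le_iff₀ (by positivity)]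
    norm_num
    calc (Real.tanh r ^ 2) ^ l * ((2 * l).factorial : ℝ) ≤
        (Real.tanh r ^ 2) ^ l * (4 ^ l * (l.factorial : ℝ) ^ 2) := by gcongr
      _ = _ := by ring
  calc _ = (√(Real.cosh r))⁻¹ ^ 2 * ((2 * l).factorial *
        (((-Real.tanh r / 2) ^ l / l.factorial) ^ 2 * (2 * l).factorial)) := by ring
    _ ≤ 1 * ((2 * l).factorial * |Real.tanh r| ^ (2 * l)) := by gcongr
    _ = _ := one_mul _

/-- Amplitudes of the output mode after `N` photons have been found in the other arm, up to a
normalisation. -/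
def outAmp (r : ℝ) (η : ℝ) (N m : ℕ) : ℂ :=
  (squeezedCoeff r (N + m) : ℂ) *
    ((Complex.I * (√η : ℂ)) ^ m / (√(m.factorial : ℝ) : ℂ))

theorem norm_sq_outAmp (r : ℝ) (η : unitInterval) (N m : ℕ) :
    ‖outAmp r η N m‖ ^ 2 = squeezedCoeff r (N + m) ^ 2 * ((η : ℝ) ^ m / m.factorial) := by
  rw [outAmp, norm_mul, norm_div, norm_pow, norm_mul, Complex.norm_I, one_mul, Complex.norm_real,
    Complex.norm_real, Complex.norm_real, Real.norm_of_nonneg (Real.sqrt_nonneg _),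
    Real.norm_of_nonneg (Real.sqrt_nonneg _), mul_pow, div_pow, Real.sq_sqrt (by positivity),
    ← pow_mul, mul_comm m 2, pow_mul, Real.sq_sqrt η.2.1, Real.norm_eq_abs, sq_abs]

/-- Writing `(N + m)!/m!` as `N!` times a binomial coefficient makes the majorant a negative
binomial series in `m`, summable in closed form. -/
theorem norm_sq_outAmp_le (r : ℝ) (η : unitInterval) (N m : ℕ) :
    ‖outAmp r η N m‖ ^ 2 ≤ N.factorial * |Real.tanh r| ^ N *
      (((m + N).choose N : ℝ) * (|Real.tanh r| * η) ^ m) := by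
  have hη := η.2.1
  rw [norm_sq_outAmp]
  have h : ((N + m).factorial : ℝ) = (m + N).choose N * N.factorial * m.factorial := by
    have := Nat.choose_mul_factorial_mul_factorial (show N ≤ m + N by omega)
    rw [Nat.add_sub_cancel] at this
    rw [add_comm N m, ← this]
    push_cast
    ring
  calc _ ≤ ((N + m).factorial * |Real.tanh r| ^ (N + m)) * ((η : ℝ) ^ m / m.factorial) := by
        gcongr
        exact squeezedCoeff_sq_le _ _
    _ = _ := by
      rw [h, mul_pow, pow_add]
      field_simp

theorem tanh_mul_lt_one (r : ℝ) (η : unitInterval) : |Real.tanh r| * η < 1 :=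
  (mul_le_of_le_one_right (abs_nonneg _) η.2.2).trans_lt (abs_tanh_lt_one r)

theorem hasSum_outAmp_bound (r : ℝ) (η : unitInterval) (N : ℕ) :
    HasSum (fun m : ℕ => N.factorial * |Real.tanh r| ^ N *
      (((m + N).choose N : ℝ) * (|Real.tanh r| * η) ^ m))
      (N.factorial * |Real.tanh r| ^ N * (1 / (1 - |Real.tanh r| * η) ^ (N + 1))) := by
  have h : ‖|Real.tanh r| * (η : ℝ)‖ < 1 := by
    rw [Real.norm_of_nonneg (mul_nonneg (abs_nonneg _) η.2.1)]
    exact tanh_mul_lt_one r η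
  exact HasSum.mul_left ((N.factorial : ℝ) * |Real.tanh r| ^ N)
    (hasSum_choose_mul_geometric_of_norm_lt_one N h)

/-- The vector of the output mode with amplitudes `outAmp`. -/
def outVector (r : ℝ) (η : unitInterval) (N : ℕ) : Mode :=
  ⟨outAmp r η N, memℓp_two (Summable.of_nonneg_of_le (fun _ => by positivity)
    (norm_sq_outAmp_le r η N) (hasSum_outAmp_bound r η N).summable)⟩

theorem outVector_apply (r : ℝ) (η : unitInterval) (N m : ℕ) :
    outVector r η N m = outAmp r η N m := rfl

theorem norm_sq_outVector_le (r : ℝ) (η : unitInterval) (N : ℕ) :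
    ‖outVector r η N‖ ^ 2 ≤
      N.factorial * |Real.tanh r| ^ N * (1 / (1 - |Real.tanh r| * η) ^ (N + 1)) := by
  have h := hasSum_norm_sq (outVector r η N)
  simp only [outVector_apply] at h
  exact hasSum_le (norm_sq_outAmp_le r η N) h (hasSum_outAmp_bound r η N)

/-- The exponent `p` is kept separate from `N` for two uses: `p = N` gives summability, and `p = N -
(k + 1)` bounds the tail after powers of `(1 - η)/n` have been taken out. The right-hand side
involves neither `η` nor `n`. -/
theorem surjCoeff_mul_norm_sq_le (r : ℝ) (η : unitInterval) {k n p N : ℕ} (hn : n ≠ 0)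
    (hkn : k ≤ n) (hp : p ≤ N) :
    surjCoeff k N * ((1 - (η : ℝ)) / n) ^ p * ‖outVector r η N‖ ^ 2 ≤
      (k / (1 - |Real.tanh r|)) ^ (N - p) * |Real.tanh r| ^ N / (1 - |Real.tanh r|) := by
  obtain ⟨q, rfl⟩ := Nat.exists_eq_add_of_le hp
  rw [Nat.add_sub_cancel_left]
  have hτ := abs_tanh_lt_one r
  have hτ0 := abs_nonneg (Real.tanh r)
  have hη0 := η.2.1
  have hη1 := η.2.2
  have hw := norm_sq_outVector_le r η (p + q)
  have hle : |Real.tanh r| * η ≤ |Real.tanh r| := mul_le_of_le_one_right hτ0 hη1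
  have hle' : |Real.tanh r| * η ≤ η := mul_le_of_le_one_left hη0 hτ.le
  generalize |Real.tanh r| = τ at *
  have h1 : 0 < 1 - τ := by linarith
  have h2 : 0 < 1 - τ * η := by linarith
  have hn' : (0 : ℝ) < n := by positivity
  have hk : (k : ℝ) / n ≤ 1 := by
    rw [div_le_one hn']
    exact_mod_cast hkn
  have he : (1 - (η : ℝ)) / (1 - τ * η) ≤ 1 := by
    rw [div_le_one h2]
    linarith
  have h3 : 0 ≤ 1 - (η : ℝ) := by linarith
  calc _ ≤ ((k : ℝ) ^ (p + q) / (p + q).factorial) * ((1 - (η : ℝ)) / n) ^ p *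
        ((p + q).factorial * τ ^ (p + q) * (1 / (1 - τ * η) ^ (p + q + 1))) := by
        gcongr
        exact surjCoeff_le _ _
    -- The factorials cancel. The `p` powers of `1/n` and `1 - η` are paired with `k` and `1/(1 -
    -- τη)` into ratios at most `1`; the other `q` powers are bounded crudely with `η ≤ 1`.
    _ = ((k : ℝ) / n) ^ p * ((1 - (η : ℝ)) / (1 - τ * η)) ^ p *
        ((k / (1 - τ * η)) ^ q * τ ^ (p + q) / (1 - τ * η)) := by
        have hf : ((p + q).factorial : ℝ) ≠ 0 := by positivity
        have hd := h2.ne'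
        generalize 1 - τ * (η : ℝ) = d at hd ⊢
        generalize ((p + q).factorial : ℝ) = f at hf ⊢
        generalize 1 - (η : ℝ) = e
        simp only [div_pow, pow_add, pow_one]
        field_simp
    _ ≤ 1 ^ p * 1 ^ p * ((k / (1 - τ)) ^ q * τ ^ (p + q) / (1 - τ)) := by
        gcongr
    _ = _ := by ring

theorem summable_surjCoeff_mul_norm_sq (r : ℝ) (η : unitInterval) {k n : ℕ} (hn : n ≠ 0)
    (hkn : k ≤ n) :
    Summable fun N => surjCoeff k N * ((1 - (η : ℝ)) / n) ^ N * ‖outVector r η N‖ ^ 2 := by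
  have hη : 0 ≤ 1 - (η : ℝ) := by linarith [η.2.2]
  refine Summable.of_nonneg_of_le (fun N => ?_) (fun N => ?_)
    ((summable_geometric_of_lt_one (abs_nonneg _) (abs_tanh_lt_one r)).div_const
      (1 - |Real.tanh r|))
  · have := surjCoeff_nonneg k N
    positivity
  · simpa using surjCoeff_mul_norm_sq_le r η hn hkn (le_refl N)

theorem summable_shifted_norm_sq (r : ℝ) (η : unitInterval) {k n : ℕ} (hn : n ≠ 0)
    (hkn : k ≤ n) :
    (Summable fun M => surjCoeff k (M + (k + 1)) * ((1 - (η : ℝ)) / n) ^ M *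
      ‖outVector r η (M + (k + 1))‖ ^ 2) ∧
    ∑' M, surjCoeff k (M + (k + 1)) * ((1 - (η : ℝ)) / n) ^ M *
      ‖outVector r η (M + (k + 1))‖ ^ 2 ≤
      (k / (1 - |Real.tanh r|)) ^ (k + 1) / (1 - |Real.tanh r|) / (1 - |Real.tanh r|) := by
  have hη : 0 ≤ 1 - (η : ℝ) := by linarith [η.2.2]
  have h1 : 0 < 1 - |Real.tanh r| := by linarith [abs_tanh_lt_one r]
  have hs := ((hasSum_geometric_of_lt_one (abs_nonneg _) (abs_tanh_lt_one r)).mul_left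
    ((k / (1 - |Real.tanh r|)) ^ (k + 1) / (1 - |Real.tanh r|)))
  have hle : ∀ M, surjCoeff k (M + (k + 1)) * ((1 - (η : ℝ)) / n) ^ M *
      ‖outVector r η (M + (k + 1))‖ ^ 2 ≤
      (k / (1 - |Real.tanh r|)) ^ (k + 1) / (1 - |Real.tanh r|) * |Real.tanh r| ^ M := by
    intro M
    have h := surjCoeff_mul_norm_sq_le r η hn hkn (show M ≤ M + (k + 1) by omega)
    rw [Nat.add_sub_cancel_left] at h
    refine h.trans ?_
    rw [mul_div_right_comm]
    gcongr ?_ * ?_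
    exact pow_le_pow_of_le_one (abs_nonneg _) (abs_tanh_lt_one r).le (by omega)
  have hsum : Summable fun M => surjCoeff k (M + (k + 1)) * ((1 - (η : ℝ)) / n) ^ M *
      ‖outVector r η (M + (k + 1))‖ ^ 2 :=
    Summable.of_nonneg_of_le (fun M => by
      have := surjCoeff_nonneg k (M + (k + 1))
      positivity) hle hs.summable
  refine ⟨hsum, ?_⟩
  rw [div_eq_mul_inv _ (1 - |Real.tanh r|)]
  exact hasSum_le hle hsum.hasSum hs

/-! ### The conditional state as a sum over photon numbers -/

theorem adjoint_detectorKet_apply {D : Type*} (c : D →₀ ℕ) (ψ : Fock (D ⊕ Unit)) (j : ℕ) :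
    adjoint (detectorKet c) ψ j = ψ (Finsupp.sumElim c (Finsupp.single () j)) :=
  adjoint_basisIncl_apply _ _ _

/-- Parseval's identity, with the basis grouped by detector pattern. -/
theorem hasSum_norm_sq_detectorKet {D : Type*} (ψ : Fock (D ⊕ Unit)) :
    HasSum (fun c : D →₀ ℕ => ‖adjoint (detectorKet c) ψ‖ ^ 2) (‖ψ‖ ^ 2) := by
  let e : (D →₀ ℕ) × ℕ ≃ (D ⊕ Unit →₀ ℕ) :=
    ((Equiv.refl _).prodCongr (Finsupp.uniqueEquiv ()).symm).trans
      Finsupp.sumFinsuppEquivProdFinsupp.symm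
  have he : ∀ c j, e (c, j) = Finsupp.sumElim c (Finsupp.single () j) := by
    intro c j
    rfl
  have h1 := e.hasSum_iff.2 (hasSum_norm_sq ψ)
  refine h1.prod_fiberwise fun c => ?_
  have h2 := hasSum_norm_sq (adjoint (detectorKet c) ψ)
  simp only [adjoint_detectorKet_apply] at h2
  simpa only [Function.comp, he] using h2

section Protocol

variable {D : Type*} [Fintype D]

theorem clickProj_apply (k : ℕ) (ψ : Fock (D ⊕ Unit)) (m : D ⊕ Unit →₀ ℕ) :
    clickProj D k ψ m =
      if (Finset.univ.filter fun d => m (Sum.inl d) ≠ 0).card = k then ψ m else 0 := by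
  classical
  have h1 : clickProj D k ψ m = ∑ S ∈ Finset.powersetCard k (Finset.univ : Finset D),
      (diagProj {m : D ⊕ Unit →₀ ℕ | ∀ d, m (Sum.inl d) ≠ 0 ↔ d ∈ S} ψ) m := by
    rw [← inner_ket, clickProj, sum_apply, inner_sum]
    simp only [inner_ket]
  have h2 : ∀ S : Finset D, (∀ d, m (Sum.inl d) ≠ 0 ↔ d ∈ S) ↔
      (Finset.univ.filter fun d => m (Sum.inl d) ≠ 0) = S := fun S => by
    simp [Finset.ext_iff]
  rw [h1]
  simp only [diagProj_apply, Set.mem_ofPred_eq, h2, Finset.sum_ite_eq]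
  simp [Finset.mem_powersetCard]

theorem adjoint_clickProj (k : ℕ) : adjoint (clickProj D k) = clickProj D k := by
  simp only [clickProj, map_sum, adjoint_diagProj]

theorem clickProj_clickProj (k : ℕ) (ψ : Fock (D ⊕ Unit)) :
    clickProj D k (clickProj D k ψ) = clickProj D k ψ := by
  ext m
  simp only [clickProj_apply]
  split_ifs <;> rfl

variable [DecidableEq D]

/-- Patterns with equal photon number leave the output mode in the same direction; the network
affects only the scalar. -/
theorem adjoint_detectorKet_clickProj (W : Matrix.unitaryGroup D ℂ) (d₀ : D) (r : ℝ)
    (η : unitInterval) (k : ℕ) (c : D →₀ ℕ) :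
    adjoint (detectorKet c) (clickProj D k (distributedState W d₀ r η)) =
      (if c.support.card = k then
        (∏ d, ((W : Matrix D D ℂ) d d₀ ^ c d / (√((c d).factorial : ℝ) : ℂ))) *
          (√(1 - η : ℝ) : ℂ) ^ (∑ d, c d) else 0) • outVector r η (∑ d, c d) := by
  ext j
  have hc : (Finset.univ.filter fun d =>
      (Finsupp.sumElim c (Finsupp.single () j)) (Sum.inl d) ≠ 0) = c.support := by
    ext d
    rw [Finset.mem_filter, Finsupp.mem_support_iff, Finsupp.sumElim_inl]
    simp
  rw [adjoint_detectorKet_apply, clickProj_apply, hc, distributedState_apply, lp.coeFn_smul,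
    Pi.smul_apply, outVector_apply, outAmp]
  simp only [smul_eq_mul, ite_mul, zero_mul, mul_assoc]

/-- The one place where balance is used. Phases of the entries of `W` drop out, so any balanced
network gives the same weights. -/
theorem norm_sq_detectorCoeff {W : Matrix.unitaryGroup D ℂ} {d₀ : D} {n : ℕ}
    (hW : ∀ l, ‖(W : Matrix D D ℂ) l d₀‖ ^ 2 = 1 / n) (η : unitInterval) (k : ℕ) (c : D →₀ ℕ) :
    ‖if c.support.card = k then
        (∏ d, ((W : Matrix D D ℂ) d d₀ ^ c d / (√((c d).factorial : ℝ) : ℂ))) *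
          (√(1 - η : ℝ) : ℂ) ^ (∑ d, c d) else 0‖ ^ 2 =
      (if c.support.card = k then (∏ d, ((c d).factorial : ℝ))⁻¹ else 0) *
        ((1 - (η : ℝ)) / n) ^ (∑ d, c d) := by
  split_ifs with h
  · have h1 : ∀ d, ‖(W : Matrix D D ℂ) d d₀ ^ c d / (√((c d).factorial : ℝ) : ℂ)‖ ^ 2 =
        ((c d).factorial : ℝ)⁻¹ * (1 / n) ^ c d := by
      intro d
      rw [norm_div, norm_pow, Complex.norm_real, Real.norm_of_nonneg (Real.sqrt_nonneg _), div_pow,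
        Real.sq_sqrt (by positivity), ← pow_mul, mul_comm (c d) 2, pow_mul, hW]
      ring
    have h2 : 0 ≤ 1 - (η : ℝ) := by linarith [η.2.2]
    rw [norm_mul, norm_prod, mul_pow, ← Finset.prod_pow, Finset.prod_congr rfl fun d _ => h1 d,
      Finset.prod_mul_distrib, Finset.prod_pow_eq_pow_sum, norm_pow, Complex.norm_real,
      Real.norm_of_nonneg (Real.sqrt_nonneg _), ← pow_mul, mul_comm _ 2, pow_mul,
      Real.sq_sqrt h2, Finset.prod_inv_distrib, mul_assoc, ← mul_pow]
    ring
  · simp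

theorem rankOne_smul_smul {E : Type*} [NormedAddCommGroup E] [InnerProductSpace ℂ E] (a : ℂ)
    (x : E) : rankOne ℂ (a • x) (a • x) = (‖a‖ ^ 2) • rankOne ℂ x x := by
  ext y
  simp only [rankOne_apply, inner_smul_left, smul_apply, smul_smul]
  rw [mul_right_comm, Complex.conj_mul', ← Complex.coe_smul, smul_smul]
  push_cast
  rfl

theorem clickProb_eq {W : Matrix.unitaryGroup D ℂ} {d₀ : D} {r : ℝ} {η : unitInterval} {k : ℕ} :
    clickProb W d₀ r η k = ‖clickProj D k (distributedState W d₀ r η)‖ ^ 2 := by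
  have h : clickProb W d₀ r η k = (inner ℂ (clickProj D k (distributedState W d₀ r η))
      (clickProj D k (distributedState W d₀ r η))).re := by
    rw [← adjoint_inner_right, adjoint_clickProj, clickProj_clickProj, clickProb]
  rw [h, inner_self_eq_norm_sq_to_K]
  norm_cast

variable {W : Matrix.unitaryGroup D ℂ} {d₀ : D} {n k : ℕ}

theorem hasSum_clickProb (hW : ∀ l, ‖(W : Matrix D D ℂ) l d₀‖ ^ 2 = 1 / n) (hn : n ≠ 0)
    (hk : k ≤ n) (r : ℝ) (η : unitInterval) :
    HasSum (fun N => ((Fintype.card D).choose k : ℝ) *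
      (surjCoeff k N * ((1 - (η : ℝ)) / n) ^ N * ‖outVector r η N‖ ^ 2))
      (clickProb W d₀ r η k) := by
  have hη : 0 ≤ 1 - (η : ℝ) := by linarith [η.2.2]
  have hs := summable_surjCoeff_mul_norm_sq r η hn hk
  have h1 := hasSum_of_card_support (D := D) k
    (fun N => ((1 - (η : ℝ)) / n) ^ N * ‖outVector r η N‖ ^ 2) (hs.congr fun N => by
      rw [Real.norm_of_nonneg (by positivity), mul_assoc])
  have h2 := hasSum_norm_sq_detectorKet (clickProj D k (distributedState W d₀ r η))
  simp only [adjoint_detectorKet_clickProj, norm_smul, mul_pow, norm_sq_detectorCoeff hW] at h2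
  simp only [smul_eq_mul, mul_assoc] at h1 h2
  have h3 := h1.unique h2
  rw [clickProb_eq, ← h3]
  simp only [mul_assoc] at hs ⊢
  exact (hs.mul_left _).hasSum

theorem hasSum_traceDetectors (hW : ∀ l, ‖(W : Matrix D D ℂ) l d₀‖ ^ 2 = 1 / n) (hn : n ≠ 0)
    (hk : k ≤ n) (r : ℝ) (η : unitInterval) :
    HasSum (fun N => (((Fintype.card D).choose k : ℝ) *
      (surjCoeff k N * ((1 - (η : ℝ)) / n) ^ N)) • rankOne ℂ (outVector r η N) (outVector r η N))
      (traceDetectors (clickProj D k ∘L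
        rankOne ℂ (distributedState W d₀ r η) (distributedState W d₀ r η) ∘L clickProj D k)) := by
  have hη : 0 ≤ 1 - (η : ℝ) := by linarith [η.2.2]
  have hs := summable_surjCoeff_mul_norm_sq r η hn hk
  have h1 := hasSum_of_card_support (D := D) k
    (fun N => ((1 - (η : ℝ)) / n) ^ N • rankOne ℂ (outVector r η N) (outVector r η N))
    (hs.congr fun N => by
      rw [norm_smul, Real.norm_of_nonneg (by positivity), norm_rankOne, mul_assoc, sq ‖_‖])
  have h2 : ∀ c : D →₀ ℕ, adjoint (detectorKet c) ∘L (clickProj D k ∘L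
      rankOne ℂ (distributedState W d₀ r η) (distributedState W d₀ r η) ∘L clickProj D k) ∘L
      detectorKet c = (if c.support.card = k then (∏ d, ((c d).factorial : ℝ))⁻¹ else 0) •
        (((1 - (η : ℝ)) / n) ^ (∑ d, c d) •
          rankOne ℂ (outVector r η (∑ d, c d)) (outVector r η (∑ d, c d))) := by
    intro c
    rw [rankOne_comp, adjoint_clickProj, comp_rankOne, rankOne_comp, comp_rankOne,
      adjoint_detectorKet_clickProj, rankOne_smul_smul, norm_sq_detectorCoeff hW, smul_smul]
    rfl
  rw [traceDetectors, tsum_congr h2, h1.tsum_eq]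
  simp only [smul_smul, mul_assoc]
  refine Summable.hasSum (Summable.of_norm ?_)
  refine (hs.mul_left ((Fintype.card D).choose k : ℝ)).congr fun N => ?_
  have := surjCoeff_nonneg k N
  rw [norm_smul, Real.norm_of_nonneg (by positivity), norm_rankOne]
  ring

theorem clickProb_smul_heraldedState (W : Matrix.unitaryGroup D ℂ) (d₀ : D) (k : ℕ) (r : ℝ) (η : unitInterval) :
    (clickProb W d₀ r η k : ℂ) • heraldedState W d₀ r η k =
      traceDetectors (clickProj D k ∘L
        rankOne ℂ (distributedState W d₀ r η) (distributedState W d₀ r η) ∘L clickProj D k) := by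
  -- When the probability vanishes so does the projected vector, hence the traced operator is `0` as
  -- well, and the junk value of the inverse in `heraldedState` is harmless.
  by_cases h : clickProb W d₀ r η k = 0
  · have h0 : clickProj D k (distributedState W d₀ r η) = 0 := by
      rwa [clickProb_eq, sq_eq_zero_iff, norm_eq_zero] at h
    rw [h, rankOne_comp, adjoint_clickProj, comp_rankOne, h0]
    simp [traceDetectors]
  · rw [heraldedState, smul_smul, mul_inv_cancel₀ (by exact_mod_cast h), one_smul]

end Protocol

/-! ### Gaussian moments -/

theorem integral_norm_pow_mul_gaussian (M : ℕ) {b : ℝ} (hb : 0 < b) :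
    ∫ α : ℂ, ‖α‖ ^ M * Real.exp (-b * ‖α‖ ^ 2) =
      Real.pi * b ^ (-((M : ℝ) + 2) / 2) * Real.Gamma (((M : ℝ) + 2) / 2) := by
  have := Complex.integral_rpow_mul_exp_neg_mul_rpow (p := 2) (q := M) (b := b) (by norm_num)
    (by linarith [Nat.cast_nonneg (α := ℝ) M]) hb
  simp only [Real.rpow_natCast, Real.rpow_two] at this
  rw [this]
  ring

theorem integrable_norm_pow_mul_gaussian (M : ℕ) {b : ℝ} (hb : 0 < b) :
    Integrable fun α : ℂ => ‖α‖ ^ M * Real.exp (-b * ‖α‖ ^ 2) := by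
  -- A non-integrable function has integral `0` by convention, so a positive value of the integral
  -- already proves integrability.
  refine .of_integral_ne_zero ?_
  rw [integral_norm_pow_mul_gaussian M hb]
  have := Real.Gamma_pos_of_pos (show 0 < ((M : ℝ) + 2) / 2 by positivity)
  have := Real.pi_pos
  positivity

/-- On the diagonal this is a Gamma integral. Off the diagonal, rotating `α` by the angle `π/(M -
j)` preserves the measure and multiplies the integrand by `-1`. -/
theorem integral_conj_pow_mul_pow (j M : ℕ) :
    ∫ α : ℂ, conj α ^ j * (α ^ M * (Real.exp (-‖α‖ ^ 2) : ℂ)) =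
      if j = M then (Real.pi : ℂ) * M.factorial else 0 := by
  split_ifs with h
  · subst h
    have h1 : ∀ α : ℂ, conj α ^ j * (α ^ j * (Real.exp (-‖α‖ ^ 2) : ℂ)) =
        ((‖α‖ ^ (2 * j) * Real.exp (-1 * ‖α‖ ^ 2) : ℝ) : ℂ) := by
      intro α
      rw [← mul_assoc, ← mul_pow, Complex.conj_mul', pow_mul]
      push_cast
      rw [neg_one_mul]
    simp only [h1]
    rw [integral_complex_ofReal, integral_norm_pow_mul_gaussian _ one_pos, Real.one_rpow, mul_one,
      show ((2 * j : ℕ) + 2 : ℝ) / 2 = j + 1 by push_cast; ring, Real.Gamma_nat_eq_factorial]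
    push_cast
    rfl
  · have hd : (M : ℝ) - j ≠ 0 := sub_ne_zero.2 (by exact_mod_cast Ne.symm h)
    set a : Circle := Circle.exp (Real.pi / (M - j))
    have ha : (conj (a : ℂ)) ^ j * (a : ℂ) ^ M = -1 := by
      have hd' : (M : ℂ) - j ≠ 0 := by exact_mod_cast hd
      rw [Circle.coe_exp, ← Complex.exp_conj, ← Complex.exp_nat_mul, ← Complex.exp_nat_mul,
        ← Complex.exp_add, ← Complex.exp_pi_mul_I]
      congr 1
      simp only [map_mul, Complex.conj_I, Complex.conj_ofReal]
      push_cast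
      field_simp
      ring
    have h2 := (LinearIsometryEquiv.measurePreserving (rotation a)).integral_comp'
      (f := (rotation a).toMeasurableEquiv)
      (fun α : ℂ => conj α ^ j * (α ^ M * (Real.exp (-‖α‖ ^ 2) : ℂ)))
    have h3 : ∀ α : ℂ, conj ((rotation a).toMeasurableEquiv α) ^ j *
        ((rotation a).toMeasurableEquiv α ^ M *
          (Real.exp (-‖(rotation a).toMeasurableEquiv α‖ ^ 2) : ℂ)) =
        -(conj α ^ j * (α ^ M * (Real.exp (-‖α‖ ^ 2) : ℂ))) := by
      intro α
      have h4 : (rotation a).toMeasurableEquiv α = a * α := rfl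
      rw [h4, norm_mul, Circle.norm_coe, one_mul, map_mul, mul_pow, mul_pow]
      linear_combination (conj α ^ j * (α ^ M * (Real.exp (-‖α‖ ^ 2) : ℂ))) * ha
    simp only [h3, integral_neg] at h2
    linear_combination (-1 / 2 : ℂ) * h2

/-- Expanding the exponential in powers of `conj α ^ 2`, orthogonality keeps only the term `2 * l =
M`, so the integral reads off a Taylor coefficient. The interchange is dominated by the series of
absolute values, a Gaussian of rate `1 - |tanh r|/2 > 0`. -/
theorem integral_squeezed_kernel (r : ℝ) (M : ℕ) :
    ∫ α : ℂ, Complex.exp (-(Real.tanh r : ℂ) * conj α ^ 2 / 2) *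
      (α ^ M * (Real.exp (-‖α‖ ^ 2) : ℂ)) =
      Real.pi * (√(Real.cosh r) * squeezedCoeff r M : ℝ) := by
  have hτ := abs_tanh_lt_one r
  have hτ0 := abs_nonneg (Real.tanh r)
  have hb : 0 < 1 - |Real.tanh r| / 2 := by linarith
  let F : ℕ → ℂ → ℂ := fun l α => (-(Real.tanh r : ℂ) / 2) ^ l / l.factorial *
    (conj α ^ (2 * l) * (α ^ M * (Real.exp (-‖α‖ ^ 2) : ℂ)))
  let bound : ℕ → ℂ → ℝ := fun l α => (|Real.tanh r| / 2 * ‖α‖ ^ 2) ^ l / l.factorial *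
    (‖α‖ ^ M * Real.exp (-‖α‖ ^ 2))
  have hbs : ∀ α, HasSum (fun l => bound l α)
      (‖α‖ ^ M * Real.exp (-(1 - |Real.tanh r| / 2) * ‖α‖ ^ 2)) := by
    intro α
    have h := (NormedSpace.expSeries_div_hasSum_exp (|Real.tanh r| / 2 * ‖α‖ ^ 2)).mul_right
      (‖α‖ ^ M * Real.exp (-‖α‖ ^ 2))
    rw [← Real.exp_eq_exp_ℝ] at h
    have he : ‖α‖ ^ M * Real.exp (-(1 - |Real.tanh r| / 2) * ‖α‖ ^ 2) =
        Real.exp (|Real.tanh r| / 2 * ‖α‖ ^ 2) * (‖α‖ ^ M * Real.exp (-‖α‖ ^ 2)) := by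
      rw [mul_left_comm, ← Real.exp_add]
      ring_nf
    rw [he]
    exact h
  have key := hasSum_integral_of_dominated_convergence (μ := volume) (F := F)
    (f := fun α : ℂ => Complex.exp (-(Real.tanh r : ℂ) * conj α ^ 2 / 2) *
      (α ^ M * (Real.exp (-‖α‖ ^ 2) : ℂ))) bound
    (fun l => by
      have : Continuous (F l) := by fun_prop
      exact this.aestronglyMeasurable)
    (fun l => by
      refine .of_forall fun α => le_of_eq ?_
      simp only [F, bound, norm_mul, norm_div, norm_pow, norm_neg, Complex.norm_real,
        RCLike.norm_conj, Real.norm_eq_abs, Complex.norm_natCast, Complex.norm_ofNat,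
        abs_of_pos (Real.exp_pos _)]
      rw [mul_pow, pow_mul]
      ring)
    (.of_forall fun α => (hbs α).summable)
    (by
      simp only [fun α => (hbs α).tsum_eq]
      exact integrable_norm_pow_mul_gaussian M hb)
    (.of_forall fun α => by
      have h := (NormedSpace.expSeries_div_hasSum_exp
        (-(Real.tanh r : ℂ) * conj α ^ 2 / 2)).mul_right (α ^ M * (Real.exp (-‖α‖ ^ 2) : ℂ))
      rw [← Complex.exp_eq_exp_ℂ] at h
      refine h.congr_fun fun l => ?_
      simp only [F]
      rw [pow_mul, mul_div_right_comm, mul_pow]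
      ring)
  have hF : ∀ l, ∫ α, F l α = if 2 * l = M then
      (Real.pi * (√(Real.cosh r) * squeezedCoeff r M : ℝ) : ℂ) else 0 := by
    intro l
    simp only [F]
    rw [integral_const_mul, integral_conj_pow_mul_pow]
    split_ifs with h
    · subst h
      have hc : √(Real.cosh r) ≠ 0 := (Real.sqrt_pos.2 (Real.cosh_pos r)).ne'
      rw [squeezedCoeff_two_mul, mul_assoc (√(Real.cosh r))⁻¹, mul_inv_cancel_left₀ hc]
      push_cast
      ring
    · simp
  simp only [hF] at key
  refine key.unique ?_
  by_cases hM : Even M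
  · obtain ⟨l, rfl⟩ := hM
    convert hasSum_ite_eq l _ using 3
    · omega
  · rw [squeezedCoeff_odd hM]
    simp

/-! ### Coherent states -/

theorem coherent_apply (α : ℂ) (j : ℕ) : coherent α j =
    (Real.exp (-‖α‖ ^ 2 / 2) : ℂ) * (α ^ j / (√(j.factorial : ℝ) : ℂ)) := rfl

theorem norm_coherent (α : ℂ) : ‖coherent α‖ = 1 := by
  have h1 := hasSum_norm_sq (coherent α)
  have h2 := (NormedSpace.expSeries_div_hasSum_exp (‖α‖ ^ 2)).mul_left
    (Real.exp (-‖α‖ ^ 2 / 2) ^ 2)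
  have h3 : ∀ j, ‖coherent α j‖ ^ 2 =
      Real.exp (-‖α‖ ^ 2 / 2) ^ 2 * ((‖α‖ ^ 2) ^ j / j.factorial) := by
    intro j
    rw [coherent_apply, norm_mul, norm_div, norm_pow, Complex.norm_real, Complex.norm_real,
      mul_pow, div_pow, Real.norm_of_nonneg (Real.sqrt_nonneg _), Real.sq_sqrt (by positivity),
      Real.norm_of_nonneg (Real.exp_pos _).le, ← pow_mul, ← pow_mul, mul_comm j 2]
  simp only [h3] at h1
  have h4 := h1.unique h2
  rw [← Real.exp_eq_exp_ℝ, ← Real.exp_nat_mul, ← Real.exp_add] at h4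
  have h5 : ((2 : ℕ) : ℝ) * (-‖α‖ ^ 2 / 2) + ‖α‖ ^ 2 = 0 := by push_cast; ring
  rw [h5, Real.exp_zero] at h4
  exact (pow_eq_one_iff_of_nonneg (norm_nonneg _) two_ne_zero).1 h4

theorem norm_coherent_apply_le (α : ℂ) (j : ℕ) : ‖coherent α j‖ ≤ 1 :=
  (lp.norm_apply_le_norm (by norm_num) _ j).trans (norm_coherent α).le

/-- The partial sums of the number expansion are continuous in `α` and converge pointwise. -/
theorem stronglyMeasurable_coherent : StronglyMeasurable coherent := by
  refine stronglyMeasurable_of_tendsto Filter.atTop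
    (f := fun (s : Finset ℕ) α => ∑ j ∈ s, coherent α j • ket j) (fun s => ?_)
    (tendsto_pi_nhds.2 fun α => hasSum_ket (coherent α))
  refine Continuous.stronglyMeasurable ?_
  simp only [coherent_apply]
  fun_prop

/-! ### The coherent-state representation -/

/-- The Gaussian weight of one of the two variables of the coherent-state representation. -/
def kernelWeight (r η : ℝ) (α : ℂ) : ℂ :=
  ((√(Real.cosh r))⁻¹ : ℝ) * Complex.exp (-(Real.tanh r : ℂ) * conj α ^ 2 / 2) *
    (Real.exp (-‖α‖ ^ 2 / 2) : ℂ) * (Real.exp (-(1 - η) * ‖α‖ ^ 2 / 2) : ℂ)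

theorem continuous_kernelWeight (r η : ℝ) : Continuous (kernelWeight r η) := by
  unfold kernelWeight
  fun_prop

/-- Apart from the click factor the integrand separates, with the `β` weight the conjugate of the
same function; hence the factor `cosh r` is shared as two square roots. -/
theorem heraldIntegrand_eq (r η : ℝ) (n k : ℕ) (z : ℂ × ℂ) :
    heraldIntegrand r η n k z =
      (kernelWeight r η z.1 * conj (kernelWeight r η z.2) *
        (Complex.exp ((1 - η : ℝ) * z.1 * conj z.2 / n) - 1) ^ k) •
      rankOne ℂ (coherent (√η * Complex.I * z.1)) (coherent (√η * Complex.I * z.2)) := by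
  have hc : ((1 / Real.cosh r : ℝ) : ℂ) =
      ((√(Real.cosh r))⁻¹ : ℝ) * ((√(Real.cosh r))⁻¹ : ℝ) := by
    rw [← Complex.ofReal_mul, ← mul_inv, Real.mul_self_sqrt (Real.cosh_pos r).le, one_div]
  have he : Complex.exp (-((1 - η : ℝ) * ((‖z.1‖ : ℂ) ^ 2 + (‖z.2‖ : ℂ) ^ 2)) / 2) =
      (Real.exp (-(1 - η) * ‖z.1‖ ^ 2 / 2) : ℂ) * (Real.exp (-(1 - η) * ‖z.2‖ ^ 2 / 2) : ℂ) := by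
    rw [← Complex.ofReal_mul, ← Real.exp_add, Complex.ofReal_exp]
    congr 1
    push_cast
    ring
  have hg : ∀ α : ℂ, Complex.exp (-(‖α‖ : ℂ) ^ 2 / 2) = (Real.exp (-‖α‖ ^ 2 / 2) : ℂ) := by
    intro α
    push_cast
    rfl
  rw [heraldIntegrand, hc, he, hg, hg]
  congr 1
  simp only [kernelWeight, map_mul, Complex.conj_ofReal, ← Complex.exp_conj, map_div₀, map_neg,
    map_pow, Complex.conj_conj, Complex.conj_ofNat]
  ring

theorem norm_kernelWeight_le (r η : ℝ) (α : ℂ) :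
    ‖kernelWeight r η α‖ ≤ Real.exp (-((1 - |Real.tanh r|) / 2 + (1 - η) / 2) * ‖α‖ ^ 2) := by
  have hc : (√(Real.cosh r))⁻¹ ≤ 1 :=
    inv_le_one_of_one_le₀ (Real.one_le_sqrt.2 (Real.one_le_cosh r))
  have he : ‖Complex.exp (-(Real.tanh r : ℂ) * conj α ^ 2 / 2)‖ ≤
      Real.exp (|Real.tanh r| * ‖α‖ ^ 2 / 2) := by
    refine (Complex.norm_exp_le_exp_norm _).trans_eq ?_
    rw [norm_div, norm_mul, norm_neg, norm_pow, Complex.norm_real, RCLike.norm_conj,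
      Real.norm_eq_abs, Complex.norm_ofNat]
  have hp : 0 < (√(Real.cosh r))⁻¹ := inv_pos.2 (Real.sqrt_pos.2 (Real.cosh_pos r))
  rw [kernelWeight, norm_mul, norm_mul, norm_mul, Complex.norm_real, Complex.norm_real,
    Complex.norm_real, Real.norm_of_nonneg hp.le, Real.norm_of_nonneg (Real.exp_pos _).le,
    Real.norm_of_nonneg (Real.exp_pos _).le]
  calc _ ≤ 1 * Real.exp (|Real.tanh r| * ‖α‖ ^ 2 / 2) * Real.exp (-‖α‖ ^ 2 / 2) *
        Real.exp (-(1 - η) * ‖α‖ ^ 2 / 2) := by gcongr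
    _ = _ := by
      rw [one_mul, ← Real.exp_add, ← Real.exp_add]
      ring_nf

/-- The Gaussian exponents `1/2`, `(1 - η)/2` and `η/2` add up to `1`, so the remaining integral
over `α` no longer involves `η`. -/
theorem kernelWeight_mul_coherent (r : ℝ) (η : unitInterval) (N m : ℕ) (α : ℂ) :
    α ^ N * kernelWeight r η α * coherent (√(η : ℝ) * Complex.I * α) m =
      ((√(Real.cosh r))⁻¹ : ℝ) * ((Complex.I * (√(η : ℝ) : ℂ)) ^ m / (√(m.factorial : ℝ) : ℂ)) *
      (Complex.exp (-(Real.tanh r : ℂ) * conj α ^ 2 / 2) *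
        (α ^ (N + m) * (Real.exp (-‖α‖ ^ 2) : ℂ))) := by
  have hn : ‖(√(η : ℝ) : ℂ) * Complex.I * α‖ ^ 2 = η * ‖α‖ ^ 2 := by
    rw [norm_mul, norm_mul, Complex.norm_I, mul_one, Complex.norm_real,
      Real.norm_of_nonneg (Real.sqrt_nonneg _), mul_pow, Real.sq_sqrt η.2.1]
  have he : (Real.exp (-‖α‖ ^ 2) : ℂ) = (Real.exp (-‖α‖ ^ 2 / 2) : ℂ) *
      (Real.exp (-(1 - (η : ℝ)) * ‖α‖ ^ 2 / 2) : ℂ) * (Real.exp (-(η * ‖α‖ ^ 2) / 2) : ℂ) := by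
    rw [← Complex.ofReal_mul, ← Complex.ofReal_mul, ← Real.exp_add, ← Real.exp_add]
    ring_nf
  rw [coherent_apply, hn, he, kernelWeight, mul_pow, mul_pow, mul_pow, pow_add]
  ring

theorem integral_kernelWeight_mul_coherent (r : ℝ) (η : unitInterval) (N m : ℕ) :
    ∫ α : ℂ, α ^ N * kernelWeight r η α * coherent (√(η : ℝ) * Complex.I * α) m =
      Real.pi * outAmp r η N m := by
  have hc : (√(Real.cosh r) : ℂ) ≠ 0 := by
    exact_mod_cast (Real.sqrt_pos.2 (Real.cosh_pos r)).ne'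
  simp only [kernelWeight_mul_coherent]
  rw [integral_const_mul, integral_squeezed_kernel, outAmp]
  push_cast
  field_simp

/-! ### Absolute convergence and termwise integration of the coherent-state representation -/

section

variable {η : unitInterval} {n k : ℕ}

/-- Since `k/n ≤ 1` and `ab ≤ (a² + b²)/2`, the click factor costs no more than the decay `(1 -
η)/2` of the two weights. What is left over is the rate `(1 - |tanh r|)/2` in each variable. -/
theorem exp_sub_one_pow_le (hk : k ≤ n) (a b : ℝ) (ha : 0 ≤ a) (hb : 0 ≤ b) :
    (Real.exp ((1 - (η : ℝ)) / n * (a * b)) - 1) ^ k ≤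
      Real.exp ((1 - (η : ℝ)) / 2 * a ^ 2) * Real.exp ((1 - (η : ℝ)) / 2 * b ^ 2) := by
  have hη : 0 ≤ 1 - (η : ℝ) := by linarith [η.2.2]
  have hx : 0 ≤ (1 - (η : ℝ)) / n * (a * b) := by positivity
  have hkn : (k : ℝ) / n ≤ 1 := div_le_one_of_le₀ (by exact_mod_cast hk) (by positivity)
  calc _ ≤ Real.exp ((1 - (η : ℝ)) / n * (a * b)) ^ k := by
        gcongr
        · linarith [Real.one_le_exp hx]
        · linarith
    _ = Real.exp ((k : ℝ) / n * ((1 - (η : ℝ)) * (a * b))) := by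
        rw [← Real.exp_nat_mul]
        ring_nf
    _ ≤ Real.exp (1 * ((1 - (η : ℝ)) * ((a ^ 2 + b ^ 2) / 2))) := by
        gcongr
        nlinarith [sq_nonneg (a - b)]
    _ = _ := by
        rw [← Real.exp_add]
        ring_nf

/-- An integrable majorant of the terms of the coherent-state representation. -/
def heraldMajorant (r : ℝ) (η : unitInterval) (n k : ℕ) (z : ℂ × ℂ) : ℝ :=
  (Real.exp ((1 - (η : ℝ)) / n * (‖z.1‖ * ‖z.2‖)) - 1) ^ k *
    (‖kernelWeight r η z.1‖ * ‖kernelWeight r η z.2‖)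

theorem heraldMajorant_nonneg (r : ℝ) (z : ℂ × ℂ) : 0 ≤ heraldMajorant r η n k z := by
  have hη : 0 ≤ 1 - (η : ℝ) := by linarith [η.2.2]
  have hx : 0 ≤ (1 - (η : ℝ)) / n * (‖z.1‖ * ‖z.2‖) := by positivity
  have : 0 ≤ Real.exp ((1 - (η : ℝ)) / n * (‖z.1‖ * ‖z.2‖)) - 1 := by
    linarith [Real.one_le_exp hx]
  unfold heraldMajorant
  positivity

theorem integrable_heraldMajorant (hk : k ≤ n) (r : ℝ) :
    Integrable (heraldMajorant r η n k) := by
  have hb : 0 < (1 - |Real.tanh r|) / 2 := by linarith [abs_tanh_lt_one r]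
  have h1 := integrable_norm_pow_mul_gaussian 0 hb
  simp only [pow_zero, one_mul] at h1
  refine (h1.mul_prod h1).mono' ?_ (.of_forall fun z => ?_)
  · have := continuous_kernelWeight r η
    have : Continuous (heraldMajorant r η n k) := by
      unfold heraldMajorant
      fun_prop
    exact this.aestronglyMeasurable
  · rw [Real.norm_of_nonneg (heraldMajorant_nonneg r z)]
    calc heraldMajorant r η n k z ≤
        Real.exp ((1 - (η : ℝ)) / 2 * ‖z.1‖ ^ 2) * Real.exp ((1 - (η : ℝ)) / 2 * ‖z.2‖ ^ 2) *
        (Real.exp (-((1 - |Real.tanh r|) / 2 + (1 - (η : ℝ)) / 2) * ‖z.1‖ ^ 2) *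
          Real.exp (-((1 - |Real.tanh r|) / 2 + (1 - (η : ℝ)) / 2) * ‖z.2‖ ^ 2)) := by
          unfold heraldMajorant
          gcongr
          · exact exp_sub_one_pow_le hk _ _ (norm_nonneg _) (norm_nonneg _)
          · exact norm_kernelWeight_le r η z.1
          · exact norm_kernelWeight_le r η z.2
      _ = _ := by
        simp only [← Real.exp_add]
        ring_nf

theorem norm_exp_sub_one_le (z : ℂ) : ‖Complex.exp z - 1‖ ≤ Real.exp ‖z‖ - 1 := by
  have h1 := (hasSum_surjCoeff 1 z)
  have h2 := (hasSum_surjCoeff_real 1 ‖z‖)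
  simp only [pow_one] at h1 h2
  rw [← h1.tsum_eq]
  refine tsum_of_norm_bounded h2 fun N => ?_
  rw [norm_mul, norm_pow, Complex.norm_real, Real.norm_of_nonneg (surjCoeff_nonneg 1 N)]

theorem norm_heraldIntegrand_le (r : ℝ) (z : ℂ × ℂ) :
    ‖heraldIntegrand r η n k z‖ ≤ heraldMajorant r η n k z := by
  have hη : 0 ≤ 1 - (η : ℝ) := by linarith [η.2.2]
  have h : ‖((1 - (η : ℝ) : ℝ) : ℂ) * z.1 * conj z.2 / n‖ =
      (1 - (η : ℝ)) / n * (‖z.1‖ * ‖z.2‖) := by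
    rw [norm_div, norm_mul, norm_mul, Complex.norm_real, RCLike.norm_conj, Complex.norm_natCast,
      Real.norm_of_nonneg hη]
    ring
  rw [heraldIntegrand_eq, norm_smul, norm_rankOne, norm_coherent, norm_coherent, one_mul, mul_one,
    norm_mul, norm_mul, RCLike.norm_conj, norm_pow, heraldMajorant, mul_comm, ← h]
  gcongr
  exact norm_exp_sub_one_le _

theorem integrable_heraldIntegrand (hk : k ≤ n) (r : ℝ) :
    Integrable (heraldIntegrand r η n k) := by
  refine (integrable_heraldMajorant hk r).mono' ?_
    (.of_forall (norm_heraldIntegrand_le r))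
  have h1 : StronglyMeasurable fun z : ℂ × ℂ =>
      rankOne ℂ (coherent (√(η : ℝ) * Complex.I * z.1)) (coherent (√(η : ℝ) * Complex.I * z.2)) := by
    have hc : Continuous fun p : Mode × Mode => rankOne ℂ p.1 p.2 := by
      have : Continuous fun p : Mode × Mode => (innerSL ℂ p.2 : Mode →L[ℂ] ℂ) := by fun_prop
      simp only [rankOne_def]
      fun_prop
    have h3 : StronglyMeasurable fun z : ℂ × ℂ => coherent (√(η : ℝ) * Complex.I * z.1) :=
      stronglyMeasurable_coherent.comp_measurable (by fun_prop)
    have h4 : StronglyMeasurable fun z : ℂ × ℂ => coherent (√(η : ℝ) * Complex.I * z.2) :=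
      stronglyMeasurable_coherent.comp_measurable (by fun_prop)
    have h5 := hc.comp_stronglyMeasurable (h3.prodMk h4)
    exact h5
  have h2 : Continuous fun z : ℂ × ℂ => kernelWeight r η z.1 * conj (kernelWeight r η z.2) *
        (Complex.exp ((1 - η : ℝ) * z.1 * conj z.2 / n) - 1) ^ k := by
    have := continuous_kernelWeight r η
    fun_prop
  rw [funext (heraldIntegrand_eq r η n k)]
  exact (h2.stronglyMeasurable.smul h1).aestronglyMeasurable

/-- The matrix element `T ↦ ⟨m|T|m'⟩`. -/
def matrixElement (m m' : ℕ) : (Mode →L[ℂ] Mode) →L[ℂ] ℂ :=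
  innerSL ℂ (ket m) ∘L ContinuousLinearMap.apply ℂ Mode (ket m')

theorem matrixElement_apply (m m' : ℕ) (T : Mode →L[ℂ] Mode) :
    matrixElement m m' T = T (ket m') m := by
  simp [matrixElement, inner_ket]

theorem matrixElement_rankOne (m m' : ℕ) (x y : Mode) :
    matrixElement m m' (rankOne ℂ x y) = x m * conj (y m') := by
  rw [matrixElement_apply, rankOne_apply, lp.coeFn_smul, Pi.smul_apply, smul_eq_mul,
    ← inner_conj_symm, inner_ket, mul_comm]

theorem matrixElement_real_smul (m m' : ℕ) (c : ℝ) (T : Mode →L[ℂ] Mode) :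
    matrixElement m m' (c • T) = c * matrixElement m m' T := by
  rw [matrixElement_apply, matrixElement_apply]
  exact Complex.real_smul

theorem eq_of_matrixElement_eq {S T : Mode →L[ℂ] Mode}
    (h : ∀ m m', matrixElement m m' S = matrixElement m m' T) : S = T := by
  refine clm_ext_ket fun m' => ?_
  ext m
  simpa only [matrixElement_apply] using h m m'

/-- For a scalar matrix element, dominated convergence allows integration term by term, and each
term is a product of a function of `α` and one of `β`. -/
theorem hasSum_integral_matrixElement (hk : k ≤ n) (r : ℝ) (m m' : ℕ) :
    HasSum (fun N => (surjCoeff k N * ((1 - (η : ℝ)) / n) ^ N : ℝ) *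
      ((Real.pi * outAmp r η N m) * conj (Real.pi * outAmp r η N m')))
      (∫ z : ℂ × ℂ, matrixElement m m' (heraldIntegrand r η n k z)) := by
  have hη : 0 ≤ 1 - (η : ℝ) := by linarith [η.2.2]
  let f : ℕ → ℕ → ℂ → ℂ := fun N m α =>
    α ^ N * kernelWeight r η α * coherent (√(η : ℝ) * Complex.I * α) m
  have hfm : ∀ N m, Continuous (f N m) := by
    intro N m
    have := continuous_kernelWeight r η
    simp only [f, coherent_apply]
    fun_prop
  have hf : ∀ N m α, ‖f N m α‖ ≤ ‖α‖ ^ N * ‖kernelWeight r η α‖ := by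
    intro N m α
    simp only [f]
    rw [norm_mul, norm_mul, norm_pow]
    exact mul_le_of_le_one_right (by positivity) (norm_coherent_apply_le _ _)
  let bound : ℕ → ℂ × ℂ → ℝ := fun N z =>
    surjCoeff k N * ((1 - (η : ℝ)) / n * (‖z.1‖ * ‖z.2‖)) ^ N *
      (‖kernelWeight r η z.1‖ * ‖kernelWeight r η z.2‖)
  have hbound : ∀ z, HasSum (fun N => bound N z) (heraldMajorant r η n k z) := fun z =>
    (hasSum_surjCoeff_real k _).mul_right _
  have key := hasSum_integral_of_dominated_convergence (μ := (volume : Measure (ℂ × ℂ)))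
    (F := fun N z => ((surjCoeff k N * ((1 - (η : ℝ)) / n) ^ N : ℝ) : ℂ) *
      (f N m z.1 * conj (f N m' z.2)))
    (f := fun z => matrixElement m m' (heraldIntegrand r η n k z)) bound
    (fun N => by
      have h1 := hfm N m
      have h2 := hfm N m'
      exact Continuous.aestronglyMeasurable (by fun_prop))
    (fun N => .of_forall fun z => by
      have ha := surjCoeff_nonneg k N
      rw [norm_mul, norm_mul, Complex.norm_real, RCLike.norm_conj,
        Real.norm_of_nonneg (by positivity)]
      calc _ ≤ surjCoeff k N * ((1 - (η : ℝ)) / n) ^ N * ((‖z.1‖ ^ N * ‖kernelWeight r η z.1‖) *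
            (‖z.2‖ ^ N * ‖kernelWeight r η z.2‖)) := by
            gcongr
            · exact hf N m z.1
            · exact hf N m' z.2
        _ = _ := by
          simp only [bound, mul_pow]
          ring)
    (.of_forall fun z => (hbound z).summable)
    (by
      simp only [fun z => (hbound z).tsum_eq]
      exact integrable_heraldMajorant hk r)
    (.of_forall fun z => by
      rw [heraldIntegrand_eq, map_smul, matrixElement_rankOne, smul_eq_mul]
      have h := (hasSum_surjCoeff k ((1 - η : ℝ) * z.1 * conj z.2 / n)).mul_left
        (kernelWeight r η z.1 * conj (kernelWeight r η z.2))
      refine (h.mul_right (coherent (√(η : ℝ) * Complex.I * z.1) m *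
        conj (coherent (√(η : ℝ) * Complex.I * z.2) m'))).congr_fun fun N => ?_
      simp only [f, map_mul, map_pow]
      push_cast
      rw [div_pow, div_pow, mul_pow, mul_pow]
      ring)
  refine key.congr_fun fun N => ?_
  rw [integral_const_mul, Measure.volume_eq_prod,
    integral_prod_mul (f N m) (fun α => conj (f N m' α)), integral_conj]
  simp only [f, integral_kernelWeight_mul_coherent]

/-- The coherent-state representation of the unnormalised conditional state. -/
theorem hasSum_integral_heraldIntegrand (hn : n ≠ 0) (hk : k ≤ n) (r : ℝ) :
    HasSum (fun N => (surjCoeff k N * ((1 - (η : ℝ)) / n) ^ N) •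
      rankOne ℂ (outVector r η N) (outVector r η N))
      (((Real.pi : ℂ) ^ 2)⁻¹ • ∫ z : ℂ × ℂ, heraldIntegrand r η n k z) := by
  have hη : 0 ≤ 1 - (η : ℝ) := by linarith [η.2.2]
  have hs : Summable fun N => (surjCoeff k N * ((1 - (η : ℝ)) / n) ^ N) •
      rankOne ℂ (outVector r η N) (outVector r η N) := by
    refine Summable.of_norm ((summable_surjCoeff_mul_norm_sq r η hn hk).congr fun N => ?_)
    have := surjCoeff_nonneg k N
    rw [norm_smul, Real.norm_of_nonneg (by positivity), norm_rankOne, sq ‖_‖]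
  have hpi : (Real.pi : ℂ) ≠ 0 := by exact_mod_cast Real.pi_ne_zero
  convert hs.hasSum
  -- Both the series and the Bochner integral exist in operator norm, so continuous functionals pass
  -- through them and matrix elements decide equality.
  refine eq_of_matrixElement_eq fun m m' => ?_
  have h1 := (hasSum_integral_matrixElement (η := η) hk r m m').mul_left ((Real.pi : ℂ) ^ 2)⁻¹
  rw [(matrixElement m m').integral_comp_comm (integrable_heraldIntegrand hk r)] at h1
  have h2 := hs.hasSum.mapL (matrixElement m m')
  rw [map_smul, smul_eq_mul]
  refine h1.unique (h2.congr_fun fun N => ?_)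
  rw [matrixElement_real_smul, matrixElement_rankOne, outVector_apply,
    outVector_apply, map_mul, Complex.conj_ofReal]
  field_simp

end

theorem clickProb_smul_heraldedState_eq_integral {D : Type*} [Fintype D] [DecidableEq D]
    {W : Matrix.unitaryGroup D ℂ} {d₀ : D} {n k : ℕ}
    (hW : ∀ l, ‖(W : Matrix D D ℂ) l d₀‖ ^ 2 = 1 / n) (hn : n ≠ 0) (hk : k ≤ n) (r : ℝ)
    (η : unitInterval) :
    (clickProb W d₀ r η k : ℂ) • heraldedState W d₀ r η k =
      (((Fintype.card D).choose k : ℂ) / (Real.pi : ℂ) ^ 2) •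
        ∫ z : ℂ × ℂ, heraldIntegrand r η n k z := by
  rw [clickProb_smul_heraldedState]
  have h1 := hasSum_traceDetectors hW hn hk r η
  have h2 := (hasSum_integral_heraldIntegrand (η := η) hn hk r).const_smul
    ((Fintype.card D).choose k : ℂ)
  rw [smul_smul, ← div_eq_mul_inv] at h2
  refine h1.unique (h2.congr_fun fun N => ?_)
  refine eq_of_matrixElement_eq fun m m' => ?_
  rw [matrixElement_real_smul, map_smul, matrixElement_real_smul, smul_eq_mul]
  push_cast
  ring

/-! ### Fidelities -/

section Fidelity

variable {D : Type*} [Fintype D] [DecidableEq D] {W : Matrix.unitaryGroup D ℂ} {d₀ : D} {n k : ℕ}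

theorem hasSum_fidelityMPNR (hW : ∀ l, ‖(W : Matrix D D ℂ) l d₀‖ ^ 2 = 1 / n) (hn : n ≠ 0)
    (hk : k ≤ n) (r : ℝ) (η : unitInterval) :
    HasSum (fun N => (clickProb W d₀ r η k)⁻¹ * (((Fintype.card D).choose k : ℝ) *
      (surjCoeff k N * ((1 - (η : ℝ)) / n) ^ N *
        ‖inner ℂ (evenCat (√(k : ℝ) : ℂ)) (outVector r η N)‖ ^ 2)))
      (fidelityMPNR W d₀ r η k) := by
  set c := evenCat (√(k : ℝ) : ℂ) with hc
  let φ : (Mode →L[ℂ] Mode) →L[ℂ] ℂ := innerSL ℂ c ∘L ContinuousLinearMap.apply ℂ Mode c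
  have hφ : ∀ T, φ T = inner ℂ c (T c) := fun T => by simp [φ]
  have h1 := (Complex.hasSum_re ((hasSum_traceDetectors hW hn hk r η).mapL φ)).mul_left
    (clickProb W d₀ r η k)⁻¹
  have h2 : fidelityMPNR W d₀ r η k = (clickProb W d₀ r η k)⁻¹ * (φ (traceDetectors
      (clickProj D k ∘L rankOne ℂ (distributedState W d₀ r η) (distributedState W d₀ r η) ∘L
        clickProj D k))).re := by
    rw [fidelityMPNR, heraldedState, smul_apply, inner_smul_right, hφ, ← hc,
      ← Complex.ofReal_inv, Complex.re_ofReal_mul]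
  rw [h2]
  refine h1.congr_fun fun N => ?_
  have h3 : ∀ (a : ℝ) (w : Mode), (φ (a • rankOne ℂ w w)).re = a * ‖inner ℂ c w‖ ^ 2 := by
    intro a w
    have h4 : (a • rankOne ℂ w w) c = (a : ℂ) • (inner ℂ w c • w) := by
      ext m
      exact Complex.real_smul
    rw [hφ, h4, inner_smul_right, inner_smul_right, Complex.re_ofReal_mul,
      ← inner_conj_symm w c, Complex.conj_mul']
    norm_cast
  rw [h3]
  ring

theorem pnrVector_eq (r : ℝ) (η : unitInterval) (k : ℕ) : pnrVector r η k =
    ((√(1 - η : ℝ) : ℂ) ^ k / (√(k.factorial : ℝ) : ℂ)) • outVector r η k := by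
  ext j
  rw [pnrVector_apply, lp.coeFn_smul, Pi.smul_apply, outVector_apply, outAmp, smul_eq_mul]

theorem pnrProb_eq (r : ℝ) (η : unitInterval) (k : ℕ) : pnrProb r η k =
    (1 - (η : ℝ)) ^ k / k.factorial * ‖outVector r η k‖ ^ 2 := by
  rw [pnrProb, pnrVector_eq, norm_smul, norm_div, norm_pow, Complex.norm_real, Complex.norm_real,
    Real.norm_of_nonneg (Real.sqrt_nonneg _), Real.norm_of_nonneg (Real.sqrt_nonneg _), mul_pow,
    div_pow, Real.sq_sqrt (by positivity), ← pow_mul, mul_comm k 2, pow_mul,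
    Real.sq_sqrt (by linarith [η.2.2])]

theorem fidelityPNR_eq {r : ℝ} {η : unitInterval} {k : ℕ} (h : 0 < pnrProb r η k) :
    fidelityPNR r η k = ‖inner ℂ (evenCat (√(k : ℝ) : ℂ)) (outVector r η k)‖ ^ 2 /
      ‖outVector r η k‖ ^ 2 := by
  have ha : pnrVector r η k ≠ 0 := by
    intro h0
    rw [pnrProb, h0] at h
    simp at h
  rw [pnrVector_eq, smul_ne_zero_iff] at ha
  have ha1 := norm_ne_zero_iff.2 ha.1
  have ha2 := norm_ne_zero_iff.2 ha.2
  rw [fidelityPNR, pnrState, pnrVector_eq, inner_smul_right, inner_smul_right, norm_mul, norm_mul,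
    norm_inv, Complex.norm_real, norm_norm, norm_smul]
  field_simp

/-- The difference of ratios is `((F - f k) - (f k / g k)(G - g k)) / G`. Both terms of the
numerator lie between `0` and `B (G - g k)`, and `G ≥ g k`. -/
theorem abs_weighted_ratio_sub_le {a f g : ℕ → ℝ} {k : ℕ} {B F G : ℝ} (ha : ∀ N, 0 ≤ a N)
    (hlt : ∀ N < k, a N = 0) (hk : a k = 1) (hf : ∀ N, 0 ≤ f N) (hfg : ∀ N, f N ≤ B * g N)
    (hg : ∀ N, 0 ≤ g N) (hgk : 0 < g k) (hF : HasSum (fun N => a N * f N) F)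
    (hG : HasSum (fun N => a N * g N) G) :
    g k ≤ G ∧ |F / G - f k / g k| ≤ B * (∑' M, a (M + (k + 1)) * g (M + (k + 1))) / g k := by
  have hsplit : ∀ (u : ℕ → ℝ) (U : ℝ), HasSum (fun N => a N * u N) U →
      HasSum (fun M => a (M + (k + 1)) * u (M + (k + 1))) (U - u k) := by
    intro u U hU
    have h := (hasSum_nat_add_iff' (k + 1)).2 hU
    rwa [Finset.sum_range_succ, Finset.sum_eq_zero fun N hN => by
      rw [hlt N (Finset.mem_range.1 hN), zero_mul], hk, one_mul, zero_add] at h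
  have h1 := hsplit f F hF
  have h2 := hsplit g G hG
  have hB : 0 ≤ B := by
    by_contra hB
    nlinarith [hf k, hfg k]
  have h3 : 0 ≤ F - f k := h1.nonneg fun M => mul_nonneg (ha _) (hf _)
  have h4 : 0 ≤ G - g k := h2.nonneg fun M => mul_nonneg (ha _) (hg _)
  have h5 : F - f k ≤ B * (G - g k) := by
    refine hasSum_le (fun M => ?_) h1 (h2.mul_left B)
    calc a (M + (k + 1)) * f (M + (k + 1)) ≤ a (M + (k + 1)) * (B * g (M + (k + 1))) := by
          gcongr
          · exact ha _
          · exact hfg _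
      _ = _ := by ring
  have hGpos : 0 < G := by linarith
  refine ⟨by linarith, ?_⟩
  rw [h2.tsum_eq]
  have h6 : F / G - f k / g k = ((F - f k) - f k / g k * (G - g k)) / G := by
    field_simp
    ring
  have h7 : f k / g k ≤ B := (div_le_iff₀ hgk).2 (hfg k)
  have h8 : 0 ≤ f k / g k := div_nonneg (hf k) hgk.le
  rw [h6, abs_div, abs_of_pos hGpos]
  have h9 : |(F - f k) - f k / g k * (G - g k)| ≤ B * (G - g k) := by
    rw [abs_le]
    constructor <;> nlinarith
  gcongr
  linarith

theorem clickProb_pos_and_abs_fidelity_sub_le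
    (hW : ∀ l, ‖(W : Matrix D D ℂ) l d₀‖ ^ 2 = 1 / n) (hn : n ≠ 0) (hcard : Fintype.card D = n)
    (hk : k ≤ n) {r : ℝ} {η : unitInterval} (hp : 0 < pnrProb r η k) :
    0 < clickProb W d₀ r η k ∧
      |fidelityMPNR W d₀ r η k - fidelityPNR r η k| ≤
        ‖evenCat (√(k : ℝ) : ℂ)‖ ^ 2 *
          ((k / (1 - |Real.tanh r|)) ^ (k + 1) / (1 - |Real.tanh r|) / (1 - |Real.tanh r|)) /
          ‖outVector r η k‖ ^ 2 * ((1 - (η : ℝ)) / n) := by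
  have hη : 0 ≤ 1 - (η : ℝ) := by linarith [η.2.2]
  have hn' : (0 : ℝ) < n := by positivity
  rw [pnrProb_eq] at hp
  have hw : 0 < ‖outVector r η k‖ ^ 2 := by
    refine (sq_nonneg _).lt_of_ne' fun h => ?_
    rw [h, mul_zero] at hp
    exact hp.false
  have hx : 0 < ((1 - (η : ℝ)) / n) ^ k := by
    have h : (1 - (η : ℝ)) ^ k ≠ 0 := fun h => by
      rw [h, zero_div, zero_mul] at hp
      exact hp.false
    rw [div_pow]
    have := h.symm.lt_of_le (by positivity)
    positivity
  set x := (1 - (η : ℝ)) / n with hxdef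
  have hx0 : 0 ≤ x := by positivity
  have hch : (0 : ℝ) < (Fintype.card D).choose k := by
    exact_mod_cast Nat.choose_pos (hcard ▸ hk)
  -- Dividing out `x^k` normalises the leading weight to `1`. Truncated subtraction does no harm,
  -- because `surjCoeff k N` vanishes for `N < k`.
  let a : ℕ → ℝ := fun N => surjCoeff k N * x ^ (N - k)
  have hax : ∀ N u, surjCoeff k N * x ^ N * u = x ^ k * (a N * u) := by
    intro N u
    rcases lt_or_ge N k with h | h
    · simp [a, surjCoeff_of_lt h]
    · obtain ⟨q, rfl⟩ := Nat.exists_eq_add_of_le h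
      simp only [a, Nat.add_sub_cancel_left, pow_add]
      ring
  have hP := hasSum_clickProb hW hn hk r η
  have hM := hasSum_fidelityMPNR hW hn hk r η
  simp only [← hxdef, hax] at hP hM
  set c := evenCat (√(k : ℝ) : ℂ)
  set p := clickProb W d₀ r η k
  have hG : HasSum (fun N => a N * ‖outVector r η N‖ ^ 2)
      (p / ((Fintype.card D).choose k * x ^ k)) := by
    refine (hP.div_const ((Fintype.card D).choose k * x ^ k)).congr_fun fun N => ?_
    field_simp
  -- Only the bound `g k ≤ G` is wanted, so `f` and `B` are zero; it yields positivity of the click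
  -- probability, needed before the fidelity can be written as a quotient.
  obtain ⟨hle, -⟩ := abs_weighted_ratio_sub_le (a := a) (f := fun _ => 0) (k := k) (B := 0)
    (g := fun N => ‖outVector r η N‖ ^ 2) (F := 0)
    (fun N => mul_nonneg (surjCoeff_nonneg k N) (by positivity))
    (fun N hN => by simp only [a, surjCoeff_of_lt hN, zero_mul])
    (by simp [a, surjCoeff_self]) (fun _ => le_rfl) (fun _ => by simp) (fun _ => by positivity) hw
    (by simp) hG
  have hppos : 0 < p := by
    have := hw.trans_le hle
    rwa [lt_div_iff₀ (by positivity), zero_mul] at this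
  refine ⟨hppos, ?_⟩
  have hF : HasSum (fun N => a N * ‖inner ℂ c (outVector r η N)‖ ^ 2)
      (fidelityMPNR W d₀ r η k * (p / ((Fintype.card D).choose k * x ^ k))) := by
    refine (hM.mul_right (p / ((Fintype.card D).choose k * x ^ k))).congr_fun fun N => ?_
    field_simp
  obtain ⟨-, h⟩ := abs_weighted_ratio_sub_le (a := a)
    (f := fun N => ‖inner ℂ c (outVector r η N)‖ ^ 2) (k := k) (B := ‖c‖ ^ 2)
    (g := fun N => ‖outVector r η N‖ ^ 2)
    (fun N => mul_nonneg (surjCoeff_nonneg k N) (by positivity))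
    (fun N hN => by simp only [a, surjCoeff_of_lt hN, zero_mul])
    (by simp [a, surjCoeff_self]) (fun _ => by positivity)
    (fun N => by
      rw [← mul_pow]
      gcongr
      exact norm_inner_le_norm _ _) (fun _ => by positivity) hw hF hG
  rw [mul_div_cancel_right₀ _ (by positivity), ← fidelityPNR_eq (by rw [pnrProb_eq]; exact hp)] at h
  -- The tail starts at `N = k + 1`, so a factor `x` comes out of it; this is the rate in the
  -- theorem.
  refine h.trans ?_
  have htail : ∀ M, a (M + (k + 1)) * ‖outVector r η (M + (k + 1))‖ ^ 2 =
      x * (surjCoeff k (M + (k + 1)) * x ^ M * ‖outVector r η (M + (k + 1))‖ ^ 2) := by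
    intro M
    simp only [a, show M + (k + 1) - k = M + 1 by omega, pow_succ]
    ring
  obtain ⟨-, hs⟩ := summable_shifted_norm_sq r η hn hk
  rw [← hxdef] at hs
  rw [tsum_congr htail, tsum_mul_left]
  calc _ ≤ ‖c‖ ^ 2 * (x * ((k / (1 - |Real.tanh r|)) ^ (k + 1) / (1 - |Real.tanh r|) /
        (1 - |Real.tanh r|))) / ‖outVector r η k‖ ^ 2 := by gcongr
    _ = _ := by ring

end Fidelity

/-- A lower bound on the norm of the conditional output vector. -/
theorem squeezedCoeff_sq_mul_le (r : ℝ) (η : unitInterval) (k m : ℕ) :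
    squeezedCoeff r (k + m) ^ 2 * ((η : ℝ) ^ m / m.factorial) ≤ ‖outVector r η k‖ ^ 2 := by
  rw [← norm_sq_outAmp, ← outVector_apply]
  exact le_hasSum (hasSum_norm_sq _) m fun _ _ => by positivity

/-- The squeezed vacuum has only even photon numbers. For even `k` the vacuum component of the
output is nonzero and does not involve `η`; for odd `k` the first available component is `m = 1`, of
weight proportional to `η`, hence the need for `0 < η₀`. -/
theorem exists_pos_le_norm_sq_outVector {r : ℝ} {k : ℕ} (h : r ≠ 0 ∨ k = 0) {η₀ : ℝ}
    (h0 : Even k ∨ 0 < η₀) :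
    ∃ δ : ℝ, 0 < δ ∧ ∀ η : unitInterval, η₀ ≤ η → δ ≤ ‖outVector r η k‖ ^ 2 := by
  by_cases hk : Even k
  · have := squeezedCoeff_ne_zero hk h
    refine ⟨squeezedCoeff r k ^ 2, by positivity, fun η _ => ?_⟩
    simpa using squeezedCoeff_sq_mul_le r η k 0
  · have hη₀ : 0 < η₀ := h0.resolve_left hk
    have hk0 : k ≠ 0 := fun h => hk (h ▸ Even.zero)
    have := squeezedCoeff_ne_zero (r := r) (j := k + 1)
      (Nat.even_add_one.2 hk) (.inl (h.resolve_right hk0))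
    refine ⟨squeezedCoeff r (k + 1) ^ 2 * η₀, by positivity, fun η hη => ?_⟩
    refine le_trans ?_ (squeezedCoeff_sq_mul_le r η k 1)
    simp only [pow_one, Nat.factorial_one, Nat.cast_one, div_one]
    gcongr

theorem outVector_zero_left {k : ℕ} (hk : k ≠ 0) (η : unitInterval) : outVector 0 η k = 0 := by
  ext m
  rw [outVector_apply, outAmp, squeezedCoeff_zero_left (by omega)]
  simp

theorem exists_fidelity_bound (r : ℝ) (k : ℕ) {η₀ : ℝ} (h0 : Even k ∨ 0 < η₀) :
    ∃ C : ℝ, ∀ (η : unitInterval) (n : ℕ) (W : Matrix.unitaryGroup (Fin n) ℂ) (i₀ : Fin n),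
      (∀ l, ‖(W : Matrix (Fin n) (Fin n) ℂ) l i₀‖ ^ 2 = 1 / n) → k ≤ n → η₀ ≤ (η : ℝ) →
      0 < pnrProb r η k → 0 < clickProb W i₀ r η k ∧
        |fidelityMPNR W i₀ r η k - fidelityPNR r η k| ≤ C * ((1 - (η : ℝ)) / n) := by
  by_cases h : r ≠ 0 ∨ k = 0
  · obtain ⟨δ, hδ, hδle⟩ := exists_pos_le_norm_sq_outVector h h0
    refine ⟨‖evenCat (√(k : ℝ) : ℂ)‖ ^ 2 *
      ((k / (1 - |Real.tanh r|)) ^ (k + 1) / (1 - |Real.tanh r|) / (1 - |Real.tanh r|)) / δ,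
      fun η n W i₀ hW hkn hη hp => ?_⟩
    have h1 : 0 ≤ 1 - |Real.tanh r| := by linarith [abs_tanh_lt_one r]
    have h2 : 0 ≤ 1 - (η : ℝ) := by linarith [η.2.2]
    obtain ⟨hpos, hle⟩ := clickProb_pos_and_abs_fidelity_sub_le hW (Fin.pos i₀).ne'
      (Fintype.card_fin n) hkn hp
    refine ⟨hpos, hle.trans ?_⟩
    gcongr
    exact hδle η hη
  -- Without squeezing there are no photons, so an outcome `k ≠ 0` has probability zero and any
  -- constant serves.
  · obtain ⟨hr, hk⟩ := not_or.1 h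
    refine ⟨0, fun η n W i₀ _ _ _ hp => ?_⟩
    rw [pnrProb_eq, not_not.1 hr, outVector_zero_left hk] at hp
    simp at hp

theorem pnrProb_pos {r : ℝ} {η : unitInterval} {k : ℕ} (hr : r ≠ 0) (hη : (η : ℝ) < 1)
    (h : Even k ∨ 0 < (η : ℝ)) : 0 < pnrProb r η k := by
  obtain ⟨δ, hδ, hle⟩ := exists_pos_le_norm_sq_outVector (.inl hr) h
  have h1 := hδ.trans_le (hle η le_rfl)
  have h2 : 0 < 1 - (η : ℝ) := by linarith
  rw [pnrProb_eq]
  positivity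

end CatBreeding

end

theorem theorem2 (r : ℝ) (k : ℕ) :
    -- the heralded state, for every balanced lossless `n`-port network `W` with input port `i₀`
    (∀ (η : unitInterval) (n : ℕ) (W : Matrix.unitaryGroup (Fin n) ℂ) (i₀ : Fin n),
      (∀ l, ‖(W : Matrix (Fin n) (Fin n) ℂ) l i₀‖ ^ 2 = 1 / n) → k ≤ n →
        MeasureTheory.Integrable (CatBreeding.heraldIntegrand r η n k) ∧
        (CatBreeding.clickProb W i₀ r η k : ℂ) • CatBreeding.heraldedState W i₀ r η k =
          ((n.choose k : ℂ) / (Real.pi : ℂ) ^ 2) •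
            ∫ z : ℂ × ℂ, CatBreeding.heraldIntegrand r η n k z) ∧
    -- the fidelities differ by `O((1 - η) / n)`, uniformly in `η`, `n` and the network
    (∀ η₀ : ℝ, (Even k ∨ 0 < η₀) → ∃ C : ℝ,
      ∀ (η : unitInterval) (n : ℕ) (W : Matrix.unitaryGroup (Fin n) ℂ) (i₀ : Fin n),
        (∀ l, ‖(W : Matrix (Fin n) (Fin n) ℂ) l i₀‖ ^ 2 = 1 / n) → k ≤ n →
        η₀ ≤ (η : ℝ) → 0 < CatBreeding.pnrProb r η k →
          0 < CatBreeding.clickProb W i₀ r η k ∧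
          |CatBreeding.fidelityMPNR W i₀ r η k - CatBreeding.fidelityPNR r η k| ≤ C * ((1 - (η : ℝ)) / n)) ∧
    -- the conditioning outcome has positive probability
    (∀ η : unitInterval, r ≠ 0 → (η : ℝ) < 1 → (Even k ∨ 0 < (η : ℝ)) → 0 < CatBreeding.pnrProb r η k) := by
  refine ⟨fun η n W i₀ hW hk => ⟨CatBreeding.integrable_heraldIntegrand hk r, ?_⟩,
    fun η₀ h0 => CatBreeding.exists_fidelity_bound r k h0,
    fun η hr hη h => CatBreeding.pnrProb_pos hr hη h⟩
  simpa only [Fintype.card_fin] using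
    CatBreeding.clickProb_smul_heraldedState_eq_integral hW (Fin.pos i₀).ne' hk r η
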